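/- Let $(\Omega,\mathcal F,\mathbb P)$ be a probability space and let $X=(X_t)_{t\ge 0}$ be a real stochastic process on it all of whose trajectories are càdlàg. For $c\ge 0$, $0\le s\le t<\infty$ and $x:[0,\infty)\to\mathbb R$, the truncated variation of $x$ on $[s,t]$ is $$\mathrm{TV}^c(x,[s,t])=\sup\sum_{i=1}^{n}\max\{|x_{u_i}-x_{u_{i-1}}|-c,\,0\},$$ where the supremum is over all finite partitions $s=u_0\le u_1\le\dots\le u_n=t$ of $[s,t]$. Assume that 1. $X$ is self-similar with index $\beta>0$: for every $A>0$ the processes $(A^{-\beta}X_{At})_{t\ge0}$ and $(X_t)_{t\ge0}$ have the same law; 2. $X$ has stationary increments: for all $0\le t_1<t_2<\dots<t_n$ and $h>0$, the vectors $(X_{t_{i+1}}-X_{t_i})_{1\le i<n}$ and $(X_{t_{i+1}+h}-X_{t_i+h})_{1\le i<n}$ have the same law; 3. $\mathbb E\,\mathrm{TV}^{c_0}(X,[0,1])<\infty$ for some $c_0>0$; 4. for every integer $k\ge1$ the stationary sequence $\big(\mathrm{TV}^1(X,[0,k]),\mathrm{TV}^1(X,[k,2k]),\mathrm{TV}^1(X,[2k,3k]),\dots\big)$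 is ergodic. Then the limit $$C=\lim_{n\to\infty}\frac{\mathbb E\,\mathrm{TV}^1(X,[0,n])}{n}$$ exists in $[0,\infty)$, and $C>0$ unless almost surely $X_t=0$ for all $t\ge0$. Moreover, there are a sequence of positive reals $(c_n)$ with $c_n\to0$ and a measurable set $\Omega_X\subset\Omega$ with $\mathbb P(\Omega_X)=1$ such that for each $\omega\in\Omega_X$ and each $t\in[0,\infty)$ $$c_n^{1/\beta-1}\,\mathrm{TV}^{c_n}(X(\omega),[0,t])\longrightarrow C\cdot t\qquad\text{as } n\to\infty.$$ -/

import Mathlib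

open MeasureTheory ProbabilityTheory Filter Topology
open scoped NNReal ENNReal

/-- The truncated variation of the path `x : [0, ∞) → ℝ` with truncation parameter `c ≥ 0` on the
time interval `[s, t]`: the supremum, over all finite partitions `s = u 0 ≤ u 1 ≤ ⋯ ≤ u n = t`, of
`∑ (|x (u (i + 1)) - x (u i)| - c)₊`. Here `ENNReal.ofReal` is the positive part, and degenerate
subintervals contribute `(0 - c)₊ = 0`, so that allowing them does not change the supremum.
The value is an extended non-negative real, so no finiteness is presupposed. -/
noncomputable def truncVar (x : ℝ≥0 → ℝ) (c : ℝ) (s t : ℝ≥0) : ℝ≥0∞ :=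
  ⨆ (n : ℕ) (u : ℕ → ℝ≥0) (_ : Monotone u ∧ u 0 = s ∧ u n = t),
    ∑ i ∈ Finset.range n, ENNReal.ofReal (|x (u (i + 1)) - x (u i)| - c)

/-- Càdlàg path on `[0, ∞)`: right-continuous everywhere with finite left limits at each `t > 0`. -/
def IsCadlagPath (x : ℝ≥0 → ℝ) : Prop :=
  (∀ t, ContinuousWithinAt x (Set.Ici t) t) ∧
    ∀ t, 0 < t → ∃ l : ℝ, Tendsto x (𝓝[<] t) (𝓝 l)

/-- Self-similarity with index `β`: for every `A > 0` the processes `(A ^ (-β) * X (A t))_t` and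
`(X t)_t` have the same law on the path space `ℝ≥0 → ℝ` with its product σ-algebra (that is, the
same finite-dimensional distributions). -/
def IsSelfSimilarProcess {Ω : Type*} [MeasurableSpace Ω] (P : Measure Ω)
    (X : ℝ≥0 → Ω → ℝ) (β : ℝ) : Prop :=
  ∀ A : ℝ≥0, 0 < A →
    IdentDistrib (fun ω (t : ℝ≥0) => (A : ℝ) ^ (-β) * X (A * t) ω) (fun ω (t : ℝ≥0) => X t ω) P P

/-- Stationary increments: for `0 ≤ t 0 < t 1 < ⋯ < t n` and `h > 0`, the vector of increments of
`X` along `t` has the same law as the vector of increments along `t + h`. -/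
def HasStationaryIncrementsProcess {Ω : Type*} [MeasurableSpace Ω] (P : Measure Ω)
    (X : ℝ≥0 → Ω → ℝ) : Prop :=
  ∀ (n : ℕ) (t : Fin (n + 1) → ℝ≥0), StrictMono t → ∀ h : ℝ≥0, 0 < h →
    IdentDistrib (fun ω (i : Fin n) => X (t i.succ) ω - X (t i.castSucc) ω)
      (fun ω (i : Fin n) => X (t i.succ + h) ω - X (t i.castSucc + h) ω) P P

/-- Ergodicity of a stationary random sequence `Y 0, Y 1, …`: under the law of the sequence, every
measurable set of sequences invariant under the shift has probability `0` or `1`. Stationarity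
itself is not part of this definition. -/
def IsErgodicSequence {Ω E : Type*} [MeasurableSpace Ω] [MeasurableSpace E] (P : Measure Ω)
    (Y : ℕ → Ω → E) : Prop :=
  PreErgodic (fun (y : ℕ → E) (n : ℕ) => y (n + 1)) (P.map fun ω (n : ℕ) => Y n ω)

/-! ### Pathwise properties of the truncated variation. -/

section TruncatedVariation

/-! At truncation level 1 the variation is superadditive over adjacent intervals, and subadditive up
to an error 1 per cut. With stationary increments, a(n) = E TV¹(X,[0,n]) is therefore additive up to
1, and Fekete's lemma applied on both sides yields C with a(n) ≤ Cn ≤ a(n) + 1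
(`exists_tendsto_div_of_almost_additive`). If C = 0, every a(n) vanishes; self-similarity carries
this to arbitrarily small truncation levels, so paths are constant, and it also forces X₀ = 0.

For the convergence, cut [0, mk] into m blocks of length k. The sum over blocks is within m of the
whole; for large m it is within m of m·a(k) in mean, by ergodicity and the L¹ mean ergodic theorem;
and m·a(k) is within m of Cmk. The error 3m is a fraction 3/k of the length
(`eventually_lintegral_ennDist_truncVar_le`).

Self-similarity with A = j! identifies the law of TV^c on [0,q], c = A^(-β), with that of A^(-β) TV¹
on [0,Aq]. For rational q and any prescribed k, j!·q is eventually of the form mk with m large, so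
the normalized variations converge in L¹ along c = (j!)^(-β). A subsequence then converges almost
surely at all rational times at once, and monotonicity in t gives all real times. -/

theorem sum_le_truncVar (x : ℝ≥0 → ℝ) (c : ℝ) {s t : ℝ≥0} {n : ℕ} {u : ℕ → ℝ≥0}
    (hu : Monotone u) (h0 : u 0 = s) (hn : u n = t) :
    ∑ i ∈ Finset.range n, ENNReal.ofReal (|x (u (i + 1)) - x (u i)| - c) ≤ truncVar x c s t :=
  le_iSup_of_le n <| le_iSup_of_le u <|
    le_iSup_of_le (f := fun _ : Monotone u ∧ u 0 = s ∧ u n = t =>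
      ∑ i ∈ Finset.range n, ENNReal.ofReal (|x (u (i + 1)) - x (u i)| - c)) ⟨hu, h0, hn⟩ le_rfl

theorem truncVar_le_iff {x : ℝ≥0 → ℝ} {c : ℝ} {s t : ℝ≥0} {a : ℝ≥0∞} :
    truncVar x c s t ≤ a ↔ ∀ (n : ℕ) (u : ℕ → ℝ≥0), Monotone u → u 0 = s → u n = t →
      ∑ i ∈ Finset.range n, ENNReal.ofReal (|x (u (i + 1)) - x (u i)| - c) ≤ a := by
  simp only [truncVar, iSup_le_iff, and_imp]

theorem truncVar_eq_iSup (x : ℝ≥0 → ℝ) (c : ℝ) (s t : ℝ≥0) :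
    truncVar x c s t =
      ⨆ (p : ℕ × (ℕ → ℝ≥0)) (_ : Monotone p.2 ∧ p.2 0 = s ∧ p.2 p.1 = t),
        ∑ i ∈ Finset.range p.1, ENNReal.ofReal (|x (p.2 (i + 1)) - x (p.2 i)| - c) := by
  rw [truncVar, iSup_prod]

theorem exists_monotone_zero_one {s t : ℝ≥0} (hst : s ≤ t) :
    ∃ u : ℕ → ℝ≥0, Monotone u ∧ u 0 = s ∧ u 1 = t := by
  refine ⟨fun i => if i = 0 then s else t, monotone_nat_of_le_succ fun n => ?_, by simp, by simp⟩
  by_cases h : n = 0 <;> simp [h, hst]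

theorem ofReal_increment_le_truncVar (x : ℝ≥0 → ℝ) (c : ℝ) {s t : ℝ≥0} (hst : s ≤ t) :
    ENNReal.ofReal (|x t - x s| - c) ≤ truncVar x c s t := by
  obtain ⟨u, hu, h0, h1⟩ := exists_monotone_zero_one hst
  simpa [h0, h1] using sum_le_truncVar x c hu h0 h1

/-- Superadditivity of the truncated variation over adjacent intervals. -/
theorem truncVar_add_truncVar_le (x : ℝ≥0 → ℝ) (c : ℝ) {s t r : ℝ≥0} (hst : s ≤ t) (htr : t ≤ r) :
    truncVar x c s t + truncVar x c t r ≤ truncVar x c s r := by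
  have key : ∀ (n : ℕ) (u : ℕ → ℝ≥0), Monotone u → u 0 = s → u n = t →
      ∀ (m : ℕ) (v : ℕ → ℝ≥0), Monotone v → v 0 = t → v m = r →
      ∑ i ∈ Finset.range n, ENNReal.ofReal (|x (u (i + 1)) - x (u i)| - c) +
        ∑ i ∈ Finset.range m, ENNReal.ofReal (|x (v (i + 1)) - x (v i)| - c) ≤
        truncVar x c s r := by
    intro n u hu hu0 hun m v hv hv0 hvm
    let w : ℕ → ℝ≥0 := fun i => if i ≤ n then u i else v (i - n)
    have hw : Monotone w := by
      refine monotone_nat_of_le_succ fun i => ?_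
      by_cases h1 : i + 1 ≤ n
      · simp only [w, h1, (Nat.le_succ i).trans h1, if_true]
        exact hu (Nat.le_succ i)
      · by_cases h2 : i ≤ n
        · have h3 : i = n := by omega
          subst h3
          simp only [w, h1, le_refl, if_true, if_false, hun, ← hv0]
          exact hv (Nat.zero_le _)
        · simp only [w, h1, h2, if_false]
          exact hv (by omega)
    have hwv : ∀ i, w (n + i) = v i := by
      intro i
      rcases Nat.eq_zero_or_pos i with rfl | hi
      · simp [w, hun, hv0]
      · have : ¬ n + i ≤ n := by omega
        simp [w, this]
    have hwu : ∀ i ≤ n, w i = u i := fun i hi => by simp [w, hi]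
    have := sum_le_truncVar x c (n := n + m) hw (s := s) (t := r)
      ((hwu 0 (Nat.zero_le _)).trans hu0) ((hwv m).trans hvm)
    rw [Finset.sum_range_add] at this
    refine le_trans (le_of_eq ?_) this
    congr 1
    · refine Finset.sum_congr rfl fun i hi => ?_
      have := Finset.mem_range.1 hi
      rw [hwu _ (by omega), hwu _ (by omega)]
    · refine Finset.sum_congr rfl fun i _ => ?_
      rw [add_assoc, hwv, hwv]
  rw [truncVar_eq_iSup x c s t, truncVar_eq_iSup x c t r]
  refine ENNReal.biSup_add_biSup_le' ?_ ?_ fun p hp q hq =>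
    key p.1 p.2 hp.1 hp.2.1 hp.2.2 q.1 q.2 hq.1 hq.2.1 hq.2.2
  · obtain ⟨u, hu, h0, h1⟩ := exists_monotone_zero_one hst
    exact ⟨(1, u), hu, h0, h1⟩
  · obtain ⟨u, hu, h0, h1⟩ := exists_monotone_zero_one htr
    exact ⟨(1, u), hu, h0, h1⟩

theorem truncVar_mono_right (x : ℝ≥0 → ℝ) (c : ℝ) {s t r : ℝ≥0} (hst : s ≤ t) (htr : t ≤ r) :
    truncVar x c s t ≤ truncVar x c s r :=
  le_self_add.trans (truncVar_add_truncVar_le x c hst htr)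

/-- Splitting an interval in two lowers the truncated variation by at most the truncation
parameter. -/
theorem truncVar_le_add_add (x : ℝ≥0 → ℝ) {c : ℝ} {s t r : ℝ≥0} (hst : s ≤ t)
    (htr : t ≤ r) :
    truncVar x c s r ≤ truncVar x c s t + truncVar x c t r + ENNReal.ofReal c := by
  refine truncVar_le_iff.2 fun n w hw hw0 hwn => ?_
  have h1 := sum_le_truncVar x c (n := n) (u := fun i => min (w i) t) (s := s) (t := t)
    (fun i j hij => min_le_min_right _ (hw hij)) (by simp [hw0, hst]) (by simp [hwn, htr])
  have h2 := sum_le_truncVar x c (n := n) (u := fun i => max (w i) t) (s := t) (t := r)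
    (fun i j hij => max_le_max_right _ (hw hij)) (by simp [hw0, hst]) (by simp [hwn, htr])
  -- Only a partition interval with `t` strictly inside is cut in two, and there is at most one of
  -- these; the extra `c` is paid there.
  have h3 : ∑ i ∈ Finset.range n,
      (if w i < t ∧ t < w (i + 1) then ENNReal.ofReal c else 0) ≤ ENNReal.ofReal c := by
    rw [← Finset.sum_filter, Finset.sum_const]
    have hcard : ((Finset.range n).filter fun i => w i < t ∧ t < w (i + 1)).card ≤ 1 := by
      refine Finset.card_le_one.2 fun i hi j hj => ?_
      simp only [Finset.mem_filter] at hi hj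
      rcases lt_trichotomy i j with h | h | h
      · exact absurd (hi.2.2.trans_le (hw h)) (not_lt.2 hj.2.1.le)
      · exact h
      · exact absurd (hj.2.2.trans_le (hw h)) (not_lt.2 hi.2.1.le)
    calc _ ≤ 1 • ENNReal.ofReal c := nsmul_le_nsmul_left zero_le hcard
      _ = _ := one_nsmul _
  refine le_trans ?_ (add_le_add (add_le_add h1 h2) h3)
  rw [← Finset.sum_add_distrib, ← Finset.sum_add_distrib]
  refine Finset.sum_le_sum fun i _ => ?_
  have hii := hw (Nat.le_succ i)
  rcases le_or_gt (w (i + 1)) t with ha | ha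
  · simp only [min_eq_left ha, min_eq_left (hii.trans ha)]
    exact le_self_add.trans le_self_add
  rcases le_or_gt t (w i) with hb | hb
  · simp only [max_eq_left ha.le, max_eq_left hb]
    exact le_add_self.trans le_self_add
  · simp only [hb, ha, and_self, if_true, min_eq_left hb.le, min_eq_right ha.le, max_eq_left ha.le,
      max_eq_right hb.le]
    have htri : |x (w (i + 1)) - x (w i)| ≤ |x t - x (w i)| + |x (w (i + 1)) - x t| := by
      have := abs_add_le (x t - x (w i)) (x (w (i + 1)) - x t)
      rwa [sub_add_sub_cancel'] at this
    calc ENNReal.ofReal (|x (w (i + 1)) - x (w i)| - c)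
        ≤ ENNReal.ofReal ((|x t - x (w i)| - c) + (|x (w (i + 1)) - x t| - c) + c) :=
          ENNReal.ofReal_le_ofReal (by linarith)
      _ ≤ _ := ENNReal.ofReal_add_le.trans (add_le_add_left ENNReal.ofReal_add_le _)

theorem truncVar_self (x : ℝ≥0 → ℝ) {c : ℝ} (hc : 0 ≤ c) (s : ℝ≥0) : truncVar x c s s = 0 := by
  refine le_antisymm (truncVar_le_iff.2 fun n u hu hu0 hun => ?_) zero_le
  refine (Finset.sum_eq_zero fun i hi => ?_).le
  have hi := Finset.mem_range.1 hi
  have h : ∀ j ≤ n, u j = s := fun j hj =>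
    le_antisymm (hun ▸ hu hj) (hu0 ▸ hu (Nat.zero_le j))
  rw [h i hi.le, h (i + 1) hi]
  simpa using hc

theorem truncVar_of_lt (x : ℝ≥0 → ℝ) (c : ℝ) {s t : ℝ≥0} (h : t < s) : truncVar x c s t = 0 :=
  le_antisymm (truncVar_le_iff.2 fun n _ hu hu0 hun =>
    absurd (hu (Nat.zero_le n)) (by simpa [hu0, hun] using h)) zero_le

theorem sum_truncVar_le (x : ℝ≥0 → ℝ) (c : ℝ) {u : ℕ → ℝ≥0} (hu : Monotone u) (m : ℕ) :
    ∑ i ∈ Finset.range m, truncVar x c (u i) (u (i + 1)) ≤ truncVar x c (u 0) (u m) := by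
  induction m with
  | zero => simp
  | succ m ih =>
    rw [Finset.sum_range_succ]
    exact (add_le_add_left ih _).trans
      (truncVar_add_truncVar_le x c (hu (Nat.zero_le m)) (hu (Nat.le_succ m)))

theorem truncVar_le_sum_add (x : ℝ≥0 → ℝ) {c : ℝ} (hc : 0 ≤ c) {u : ℕ → ℝ≥0}
    (hu : Monotone u) (m : ℕ) :
    truncVar x c (u 0) (u m) ≤
      ∑ i ∈ Finset.range m, truncVar x c (u i) (u (i + 1)) + m * ENNReal.ofReal c := by
  induction m with
  | zero => simp [truncVar_self x hc]
  | succ m ih =>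
    rw [Finset.sum_range_succ]
    refine (truncVar_le_add_add x (hu (Nat.zero_le m)) (hu (Nat.le_succ m))).trans ?_
    grw [ih]
    apply le_of_eq
    push_cast
    ring

/-- Only increments enter, so the base value `b` is free; taking `b` to be the value at time `h`
brings stationarity of increments to bear. -/
theorem truncVar_add_const_comp_add (x : ℝ≥0 → ℝ) (c b : ℝ) (h s t : ℝ≥0) :
    truncVar (fun r => x (r + h) - b) c s t = truncVar x c (s + h) (t + h) := by
  refine le_antisymm (truncVar_le_iff.2 fun n u hu hu0 hun => ?_)
    (truncVar_le_iff.2 fun n u hu hu0 hun => ?_)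
  · simpa using sum_le_truncVar x c (n := n) (u := fun i => u i + h) (s := s + h) (t := t + h)
      (fun i j hij => add_le_add_left (hu hij) h) (by simp [hu0]) (by simp [hun])
  · have hsub : ∀ i, u i - h + h = u i := fun i =>
      tsub_add_cancel_of_le (le_trans (by simp [hu0]) (hu (Nat.zero_le i)))
    have := sum_le_truncVar (fun r => x (r + h) - b) c (n := n) (u := fun i => u i - h)
      (s := s) (t := t) (fun i j hij => tsub_le_tsub_right (hu hij) h) (by simp [hu0])
      (by simp [hun])
    simpa [hsub] using this

theorem truncVar_scale_le (x : ℝ≥0 → ℝ) (c : ℝ) {a : ℝ} (ha : 0 < a) (A s t : ℝ≥0) :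
    truncVar (fun r => a * x (A * r)) (a * c) s t ≤
      ENNReal.ofReal a * truncVar x c (A * s) (A * t) := by
  refine truncVar_le_iff.2 fun n u hu hu0 hun => ?_
  have := sum_le_truncVar x c (n := n) (u := fun i => A * u i) (s := A * s) (t := A * t)
    (fun i j hij => mul_le_mul_right (hu hij) A) (by simp [hu0]) (by simp [hun])
  refine le_trans (le_of_eq ?_) (mul_le_mul_right this (ENNReal.ofReal a))
  rw [Finset.mul_sum]
  refine Finset.sum_congr rfl fun i _ => ?_
  rw [← ENNReal.ofReal_mul ha.le, ← mul_sub, abs_mul, abs_of_pos ha, mul_sub]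

/-- The reverse inequality is `truncVar_scale_le` for the rescaled path with the inverse factors. -/
theorem truncVar_scale (x : ℝ≥0 → ℝ) (c : ℝ) {a : ℝ} (ha : 0 < a) {A : ℝ≥0} (hA : 0 < A)
    (s t : ℝ≥0) :
    truncVar (fun r => a * x (A * r)) (a * c) s t =
      ENNReal.ofReal a * truncVar x c (A * s) (A * t) := by
  refine le_antisymm (truncVar_scale_le x c ha A s t) ?_
  have h := truncVar_scale_le (fun r => a * x (A * r)) (a * c) (inv_pos.2 ha) A⁻¹ (A * s) (A * t)
  simp only [inv_mul_cancel_left₀ ha.ne', mul_inv_cancel_left₀ hA.ne',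
    inv_mul_cancel_left₀ hA.ne'] at h
  grw [h, ← mul_assoc, ← ENNReal.ofReal_mul ha.le, mul_inv_cancel₀ ha.ne', ENNReal.ofReal_one,
    one_mul]

/-- Truncated variation restricted to partitions at rational proportions of the interval. -/
noncomputable def ratTruncVar (x : ℝ≥0 → ℝ) (c : ℝ) (s t : ℝ≥0) : ℝ≥0∞ :=
  ⨆ (n : ℕ) (u : Fin (n + 1) → ℚ≥0) (_ : Monotone u ∧ u 0 = 0 ∧ u (Fin.last n) = 1),
    ∑ i : Fin n, ENNReal.ofReal
      (|x (s + (t - s) * (u i.succ : ℝ≥0)) - x (s + (t - s) * (u i.castSucc : ℝ≥0))| - c)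

theorem measurable_ratTruncVar (c : ℝ) (s t : ℝ≥0) :
    Measurable fun x : ℝ≥0 → ℝ => ratTruncVar x c s t := by
  unfold ratTruncVar
  refine .iSup fun n => .iSup fun u => .iSup fun _ => ?_
  fun_prop

theorem ratTruncVar_le_truncVar (x : ℝ≥0 → ℝ) (c : ℝ) {s t : ℝ≥0} (hst : s ≤ t) :
    ratTruncVar x c s t ≤ truncVar x c s t := by
  refine iSup_le fun n => iSup_le fun u => iSup_le fun ⟨hu, hu0, hun⟩ => ?_
  let w : ℕ → ℝ≥0 := fun i =>
    s + (t - s) * (u ⟨min i n, Nat.lt_succ_of_le (min_le_right i n)⟩ : ℝ≥0)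
  have hw : Monotone w := fun i j hij => by
    have : u ⟨min i n, Nat.lt_succ_of_le (min_le_right i n)⟩ ≤
        u ⟨min j n, Nat.lt_succ_of_le (min_le_right j n)⟩ := hu (by simpa using Or.inl hij)
    have h2 : ((u ⟨min i n, Nat.lt_succ_of_le (min_le_right i n)⟩ : ℚ≥0) : ℝ≥0) ≤
        (u ⟨min j n, Nat.lt_succ_of_le (min_le_right j n)⟩ : ℚ≥0) := by exact_mod_cast this
    simp only [w]
    gcongr
  have hw0 : w 0 = s := by
    have : (⟨min 0 n, Nat.lt_succ_of_le (min_le_right 0 n)⟩ : Fin (n + 1)) = 0 := by ext; simp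
    simp only [w, this, hu0]; simp
  have hwn : w n = t := by
    have : (⟨min n n, Nat.lt_succ_of_le (min_le_right n n)⟩ : Fin (n + 1)) = Fin.last n := by
      ext; simp
    simp only [w, this, hun]
    simp [add_tsub_cancel_of_le hst]
  refine le_trans (le_of_eq ?_) (sum_le_truncVar x c hw hw0 hwn)
  rw [Finset.sum_range]
  refine Finset.sum_congr rfl fun i _ => ?_
  have h1 : (⟨min ((i : ℕ) + 1) n, Nat.lt_succ_of_le (min_le_right _ n)⟩ : Fin (n + 1)) =
      i.succ := by ext; simp
  have h2 : (⟨min (i : ℕ) n, Nat.lt_succ_of_le (min_le_right _ n)⟩ : Fin (n + 1)) = i.castSucc := by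
    ext; simp [i.2.le]
  simp only [w, h1, h2]

/-- Each partition point is a limit from the right of points at rational proportions, and
right-continuity passes the sums to the limit. -/
theorem truncVar_le_ratTruncVar {x : ℝ≥0 → ℝ} (hx : ∀ t, ContinuousWithinAt x (Set.Ici t) t)
    (c : ℝ) {s t : ℝ≥0} (hst : s < t) :
    truncVar x c s t ≤ ratTruncVar x c s t := by
  refine truncVar_le_iff.2 fun n u hu hu0 hun => ?_
  have hts : 0 < t - s := tsub_pos_of_lt hst
  let r : ℕ → ℝ≥0 := fun i => (u i - s) / (t - s)
  have hru : ∀ i, s + (t - s) * r i = u i := fun i => by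
    simp only [r]
    rw [mul_div_cancel₀ _ hts.ne', add_tsub_cancel_of_le (hu0 ▸ hu (Nat.zero_le i))]
  have hr : Monotone r := fun i j hij => by
    have := hu hij
    simp only [r]
    gcongr
  have hr0 : r 0 = 0 := by simp [r, hu0]
  have hrn : r n = 1 := by simp [r, hun, hts.ne']
  -- Rounding up to the grid of mesh `1 / (m + 1)` is monotone, approaches from the right, and fixes
  -- the endpoints 0 and 1.
  let q : ℕ → ℝ≥0 → ℚ≥0 := fun m a => (⌈(m + 1 : ℝ≥0) * a⌉₊ : ℚ≥0) / (m + 1)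
  have hqr : ∀ m a, a ≤ (q m a : ℝ≥0) := fun m a => by
    have : (0 : ℝ≥0) < m + 1 := by positivity
    simp only [q]
    push_cast
    rw [le_div_iff₀ this, mul_comm]
    exact Nat.le_ceil _
  have hqlim : ∀ a, Tendsto (fun m => (q m a : ℝ≥0)) atTop (𝓝 a) := fun a => by
    have hub : ∀ m, (q m a : ℝ≥0) ≤ a + 1 / ((m : ℝ≥0) + 1) := fun m => by
      have : (0 : ℝ≥0) < m + 1 := by positivity
      simp only [q]
      push_cast
      rw [div_le_iff₀ this, add_mul a, div_mul_cancel₀ _ this.ne', mul_comm a]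
      exact (Nat.ceil_lt_add_one zero_le).le
    refine tendsto_of_tendsto_of_tendsto_of_le_of_le tendsto_const_nhds ?_
      (fun m => hqr m a) hub
    simpa using tendsto_const_nhds.add (tendsto_one_div_add_atTop_nhds_zero_nat (𝕜 := ℝ≥0))
  have hle : ∀ m, ∑ i ∈ Finset.range n, ENNReal.ofReal
      (|x (s + (t - s) * (q m (r (i + 1)) : ℝ≥0)) - x (s + (t - s) * (q m (r i) : ℝ≥0))| - c) ≤
        ratTruncVar x c s t := fun m => by
    refine le_iSup_of_le n <| le_iSup_of_le (fun i => q m (r i)) ?_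
    refine le_trans ?_ (le_iSup (fun _ => _) ⟨?_, ?_, ?_⟩)
    · rw [Finset.sum_range]
      simp
    · intro i j hij
      have : r i ≤ r j := hr hij
      simp only [q]
      gcongr
    · simp [q, hr0]
    · have h1 : ⌈(m + 1 : ℝ≥0)⌉₊ = m + 1 := by exact_mod_cast Nat.ceil_natCast (R := ℝ≥0) (m + 1)
      have h2 : (m + 1 : ℚ≥0) ≠ 0 := by positivity
      simp [q, hrn, h1, h2]
  refine le_of_tendsto' (f := fun m => ∑ i ∈ Finset.range n, ENNReal.ofReal
      (|x (s + (t - s) * (q m (r (i + 1)) : ℝ≥0)) - x (s + (t - s) * (q m (r i) : ℝ≥0))| - c))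
      (x := atTop) ?_ hle
  have hxlim : ∀ i, Tendsto (fun m => x (s + (t - s) * (q m (r i) : ℝ≥0))) atTop (𝓝 (x (u i))) :=
    fun i => by
      refine (hx (u i)).tendsto.comp (tendsto_nhdsWithin_iff.2 ⟨?_, Eventually.of_forall fun m => ?_⟩)
      · rw [← hru i]
        exact tendsto_const_nhds.add (tendsto_const_nhds.mul (hqlim _))
      · have := hqr m (r i)
        rw [Set.mem_Ici, ← hru i]
        gcongr
  refine tendsto_finsetSum _ fun i _ => (ENNReal.continuous_ofReal.tendsto _).comp ?_
  exact (((hxlim (i + 1)).sub (hxlim i)).abs).sub tendsto_const_nhds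

/-- For right-continuous paths the truncated variation is a countable supremum. -/
theorem truncVar_eq_ratTruncVar {x : ℝ≥0 → ℝ} (hx : ∀ t, ContinuousWithinAt x (Set.Ici t) t)
    (c : ℝ) {s t : ℝ≥0} (hst : s < t) :
    truncVar x c s t = ratTruncVar x c s t :=
  (truncVar_le_ratTruncVar hx c hst).antisymm (ratTruncVar_le_truncVar x c hst.le)

end TruncatedVariation

/-! ### The mean ergodic theorem in L¹. -/

section MeanErgodic

theorem birkhoffAverage_real_eq {α : Type*} (T : α → α) (g : α → ℝ) (n : ℕ) :
    birkhoffAverage ℝ T g n = fun x => (n : ℝ)⁻¹ * ∑ i ∈ Finset.range n, g (T^[i] x) := by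
  ext x
  simp [birkhoffAverage, birkhoffSum]

variable {α : Type*} [MeasurableSpace α] {ν : Measure α} {T : α → α}

theorem MeasureTheory.MeasurePreserving.integrable_birkhoffAverage
    (hT : MeasurePreserving T ν ν) {g : α → ℝ} (hg : Integrable g ν) (n : ℕ) :
    Integrable (birkhoffAverage ℝ T g n) ν := by
  rw [birkhoffAverage_real_eq]
  exact (integrable_finsetSum _ fun i _ =>
    (hT.iterate i).integrable_comp_of_integrable hg).const_mul _

theorem MeasureTheory.MeasurePreserving.integral_birkhoffAverage
    (hT : MeasurePreserving T ν ν) {g : α → ℝ} (hg : Integrable g ν) {n : ℕ} (hn : n ≠ 0) :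
    ∫ x, birkhoffAverage ℝ T g n x ∂ν = ∫ x, g x ∂ν := by
  have h : ∀ i, ∫ x, g (T^[i] x) ∂ν = ∫ x, g x ∂ν := fun i => by
    have hm := hT.iterate i
    rw [← integral_map hm.aemeasurable (by rw [hm.map_eq]; exact hg.aestronglyMeasurable),
      hm.map_eq]
  rw [birkhoffAverage_real_eq, integral_const_mul, integral_finsetSum (f := fun i x => g (T^[i] x)) _ fun i _ =>
    (hT.iterate i).integrable_comp_of_integrable hg]
  simp [h, hn]

/-- Averaging is an L¹ contraction, which lets convergence pass from a dense class to all integrable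
functions. -/
theorem MeasureTheory.MeasurePreserving.eLpNorm_birkhoffAverage_le
    (hT : MeasurePreserving T ν ν) {g : α → ℝ} (hg : Integrable g ν) (n : ℕ) :
    eLpNorm (birkhoffAverage ℝ T g n) 1 ν ≤ eLpNorm g 1 ν := by
  have h1 : birkhoffAverage ℝ T g n = (n : ℝ)⁻¹ • ∑ i ∈ Finset.range n, g ∘ T^[i] := by
    ext x
    simp [birkhoffAverage_real_eq]
  have h2 : eLpNorm (∑ i ∈ Finset.range n, g ∘ T^[i]) 1 ν ≤ n * eLpNorm g 1 ν := by
    refine (eLpNorm_sum_le (fun i _ => ?_) le_rfl).trans (le_of_eq ?_)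
    · exact ((hT.iterate i).integrable_comp_of_integrable hg).aestronglyMeasurable
    · simp [eLpNorm_comp_measurePreserving hg.aestronglyMeasurable (hT.iterate _)]
  rw [h1, eLpNorm_const_smul]
  grw [h2]
  rcases Nat.eq_zero_or_pos n with rfl | hn
  · simp
  · rw [← mul_assoc, enorm_inv (by positivity), Real.enorm_natCast,
      ENNReal.inv_mul_cancel (by positivity) (by simp), one_mul]

variable [IsProbabilityMeasure ν]

/-- Mean ergodic theorem in `L¹` for square-integrable functions. -/
theorem Ergodic.tendsto_eLpNorm_birkhoffAverage_of_memLp_two (hT : Ergodic T ν) {g : α → ℝ}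
    (hg : MemLp g 2 ν) :
    Tendsto (fun n => eLpNorm (birkhoffAverage ℝ T g n - fun _ => ∫ x, g x ∂ν) 1 ν) atTop
      (𝓝 0) := by
  have hmp := hT.toMeasurePreserving
  have hgi : Integrable g ν := hg.integrable one_le_two
  let U : Lp ℝ 2 ν →ₗᵢ[ℝ] Lp ℝ 2 ν := Lp.compMeasurePreservingₗᵢ ℝ T hmp
  let V : Lp ℝ 2 ν →L[ℝ] Lp ℝ 2 ν := U.toContinuousLinearMap
  have hiter : ∀ i, V^[i] (hg.toLp g) =
      (hg.comp_measurePreserving (hmp.iterate i)).toLp (g ∘ T^[i]) := fun i => by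
    induction i with
    | zero => rfl
    | succ i ih =>
      rw [Function.iterate_succ_apply', ih]
      exact Lp.toLp_compMeasurePreserving (hg.comp_measurePreserving (hmp.iterate i)) hmp
  have havg : ∀ n, (birkhoffAverage ℝ V _root_.id n (hg.toLp g) : Lp ℝ 2 ν) =ᵐ[ν]
      birkhoffAverage ℝ T g n := fun n => by
    have h1 : ∀ᵐ x ∂ν, ∀ i, (V^[i] (hg.toLp g) : Lp ℝ 2 ν) x = g (T^[i] x) := by
      refine ae_all_iff.2 fun i => ?_
      rw [hiter i]
      exact MemLp.coeFn_toLp _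
    have h2 := Lp.coeFn_smul (n : ℝ)⁻¹ (∑ i ∈ Finset.range n, V^[i] (hg.toLp g))
    have h3 := Lp.coeFn_finsetSum (Finset.range n) fun i => V^[i] (hg.toLp g)
    filter_upwards [h1, h2, h3] with x h1 h2 h3
    simp only [birkhoffAverage, birkhoffSum, id_eq]
    rw [h2, Pi.smul_apply, h3]
    simp [h1]
  have hlim := V.tendsto_birkhoffAverage_orthogonalProjection
    U.norm_toContinuousLinearMap_le (hg.toLp g)
  generalize ((V.eqLocus (1 : Lp ℝ 2 ν →L[ℝ] Lp ℝ 2 ν)).orthogonalProjectionOnto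
    (hg.toLp g)) = L at hlim
  -- Von Neumann's limit is a `T`-invariant function, hence almost everywhere constant by
  -- ergodicity.
  have hL : Lp.compMeasurePreserving T hmp (L : Lp ℝ 2 ν) = L := L.2
  obtain ⟨c, hc⟩ := hT.ae_eq_const_of_ae_eq_comp_ae (Lp.aestronglyMeasurable (L : Lp ℝ 2 ν))
    ((Lp.coeFn_compMeasurePreserving _ hmp).symm.trans (by rw [hL]))
  have h2 : Tendsto (fun n => eLpNorm (birkhoffAverage ℝ T g n - fun _ => c) 2 ν) atTop
      (𝓝 0) := by
    refine ((Lp.tendsto_Lp_iff_tendsto_eLpNorm' _ _).1 hlim).congr fun n => eLpNorm_congr_ae ?_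
    exact (havg n).sub hc
  have h1 : Tendsto (fun n => eLpNorm (birkhoffAverage ℝ T g n - fun _ => c) 1 ν) atTop
      (𝓝 0) :=
    tendsto_of_tendsto_of_tendsto_of_le_of_le tendsto_const_nhds h2 (fun _ => zero_le)
      fun n => eLpNorm_le_eLpNorm_of_exponent_le one_le_two
        ((hmp.integrable_birkhoffAverage hgi n).aestronglyMeasurable.sub
          aestronglyMeasurable_const)
  -- The constant must be the mean, since every nonempty average has integral `∫ g`.
  suffices h : ∫ x, g x ∂ν = c by rwa [h]
  have hle : ∀ᶠ n : ℕ in atTop, ‖∫ x, g x ∂ν - c‖ₑ ≤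
      eLpNorm (birkhoffAverage ℝ T g n - fun _ => c) 1 ν := by
    filter_upwards [eventually_ne_atTop 0] with n hn
    have : ∫ x, g x ∂ν - c = ∫ x, (birkhoffAverage ℝ T g n x - c) ∂ν := by
      rw [integral_sub (hmp.integrable_birkhoffAverage hgi n) (integrable_const c),
        hmp.integral_birkhoffAverage hgi hn]
      simp
    rw [this, eLpNorm_one_eq_lintegral_enorm]
    exact enorm_integral_le_lintegral_enorm _
  have := ge_of_tendsto h1 hle
  simpa [sub_eq_zero] using this

/-- Mean ergodic theorem in `L¹`. -/
theorem Ergodic.tendsto_eLpNorm_birkhoffAverage (hT : Ergodic T ν) {f : α → ℝ}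
    (hf : Integrable f ν) :
    Tendsto (fun n => eLpNorm (birkhoffAverage ℝ T f n - fun _ => ∫ x, f x ∂ν) 1 ν) atTop
      (𝓝 0) := by
  have hmp := hT.toMeasurePreserving
  refine ENNReal.tendsto_nhds_zero.2 fun ε hε => ?_
  have hε3 : ε / 3 ≠ 0 := (ENNReal.div_pos hε.ne' (by simp)).ne'
  obtain ⟨g', hfg, hg1⟩ :=
    (memLp_one_iff_integrable.2 hf).exists_simpleFunc_eLpNorm_sub_lt (by simp) hε3
  have hgi : Integrable g' ν := memLp_one_iff_integrable.1 hg1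
  have hlim := hT.tendsto_eLpNorm_birkhoffAverage_of_memLp_two
    (g'.memLp_of_isFiniteMeasure 2 ν)
  generalize (g' : α → ℝ) = g at hfg hg1 hgi hlim
  filter_upwards [ENNReal.tendsto_nhds_zero.1 hlim (ε / 3) (pos_iff_ne_zero.2 hε3)] with n hn
  -- The outer two terms are at most `ε / 3` for every `n`, because `f - g` is small in L¹; the
  -- middle one is the square-integrable case.
  have hdec : birkhoffAverage ℝ T f n - (fun _ => ∫ x, f x ∂ν) =
      birkhoffAverage ℝ T (f - g) n + (birkhoffAverage ℝ T g n - fun _ => ∫ x, g x ∂ν) +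
        fun _ => ∫ x, (g - f) x ∂ν := by
    simp only [Pi.sub_apply]
    rw [birkhoffAverage_sub, integral_sub hgi hf]
    ext x
    simp
  have hA := hmp.integrable_birkhoffAverage (hf.sub hgi) n
  have hB := (hmp.integrable_birkhoffAverage hgi n).sub (integrable_const (∫ x, g x ∂ν))
  have h3 : eLpNorm (fun _ : α => ∫ x, (g - f) x ∂ν) 1 ν ≤ ε / 3 := by
    rw [eLpNorm_one_eq_lintegral_enorm, lintegral_const, measure_univ, mul_one]
    refine (enorm_integral_le_lintegral_enorm _).trans ?_
    rw [← eLpNorm_one_eq_lintegral_enorm, ← eLpNorm_neg, neg_sub]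
    exact hfg.le
  rw [hdec]
  calc _ ≤ eLpNorm (birkhoffAverage ℝ T (f - g) n) 1 ν +
        eLpNorm (birkhoffAverage ℝ T g n - fun _ => ∫ x, g x ∂ν) 1 ν +
          eLpNorm (fun _ : α => ∫ x, (g - f) x ∂ν) 1 ν :=
        (eLpNorm_add_le (hA.add hB).aestronglyMeasurable aestronglyMeasurable_const le_rfl).trans
          (add_le_add_left (eLpNorm_add_le hA.aestronglyMeasurable hB.aestronglyMeasurable
            le_rfl) _)
    _ ≤ ε / 3 + ε / 3 + ε / 3 :=
        add_le_add (add_le_add ((hmp.eLpNorm_birkhoffAverage_le (hf.sub hgi) n).trans hfg.le) hn) h3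
    _ = ε := ENNReal.add_thirds ε

end MeanErgodic

/-! ### Distance on the extended non-negative reals. -/

section ENNRealDistance

/-- The distance `|a - b|` on the extended non-negative reals. -/
noncomputable def ennDist (a b : ℝ≥0∞) : ℝ≥0∞ := (a - b) + (b - a)

theorem ennDist_triangle (a b c : ℝ≥0∞) : ennDist a c ≤ ennDist a b + ennDist b c := by
  unfold ennDist
  calc (a - c) + (c - a) ≤ ((a - b) + (b - c)) + ((c - b) + (b - a)) :=
        add_le_add tsub_le_tsub_add_tsub tsub_le_tsub_add_tsub
    _ = _ := by ring

theorem ennDist_mul_left {r : ℝ≥0∞} (hr : r ≠ ⊤) (a b : ℝ≥0∞) :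
    ennDist (r * a) (r * b) = r * ennDist a b := by
  simp only [ennDist, mul_add]
  rw [ENNReal.mul_sub fun _ _ => hr, ENNReal.mul_sub fun _ _ => hr]

theorem ennDist_le_of_le_of_le_add {a b d : ℝ≥0∞} (h1 : a ≤ b) (h2 : b ≤ a + d) :
    ennDist a b ≤ d := by
  rw [ennDist, tsub_eq_zero_of_le h1, zero_add]
  exact tsub_le_iff_left.2 h2

theorem ennDist_comm (a b : ℝ≥0∞) : ennDist a b = ennDist b a := add_comm _ _

theorem Measurable.ennDist_const {α : Type*} [MeasurableSpace α] {f : α → ℝ≥0∞}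
    (hf : Measurable f) (b : ℝ≥0∞) : Measurable fun x => ennDist (f x) b :=
  (hf.sub measurable_const).add (measurable_const.sub hf)

theorem ennDist_eq_enorm {a b : ℝ≥0∞} (ha : a ≠ ⊤) (hb : b ≠ ⊤) :
    ennDist a b = ‖a.toReal - b.toReal‖ₑ := by
  rcases le_total a b with h | h
  · have h' := ENNReal.toReal_mono hb h
    rw [ennDist, tsub_eq_zero_of_le h, zero_add, enorm_sub_rev,
      Real.enorm_of_nonneg (sub_nonneg.2 h'), ← ENNReal.toReal_sub_of_le h hb,
      ENNReal.ofReal_toReal (ENNReal.sub_ne_top hb)]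
  · have h' := ENNReal.toReal_mono ha h
    rw [ennDist, tsub_eq_zero_of_le h, add_zero,
      Real.enorm_of_nonneg (sub_nonneg.2 h'), ← ENNReal.toReal_sub_of_le h ha,
      ENNReal.ofReal_toReal (ENNReal.sub_ne_top ha)]

theorem tendsto_of_tendsto_ennDist {ι : Type*} {l : Filter ι} {u : ι → ℝ≥0∞} {b : ℝ≥0∞}
    (hb : b ≠ ⊤) (h : Tendsto (fun i => ennDist (u i) b) l (𝓝 0)) : Tendsto u l (𝓝 b) := by
  refine (ENNReal.tendsto_nhds hb).2 fun ε hε => ?_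
  filter_upwards [ENNReal.tendsto_nhds_zero.1 h ε hε] with i hi
  refine ⟨?_, ?_⟩
  · exact tsub_le_iff_left.2 (tsub_le_iff_right.1 (le_add_self.trans hi))
  · exact tsub_le_iff_left.1 (le_self_add.trans hi)

end ENNRealDistance

/-! ### Fekete limits, diagonal subsequences, and convergence of monotone functions. -/

section RealAndFilter

/-- A sequence that is additive up to a bounded error grows linearly. -/
theorem exists_tendsto_div_of_almost_additive {α : ℕ → ℝ} (hα : ∀ n, 0 ≤ α n)
    (hsup : ∀ m n, α m + α n ≤ α (m + n)) (hsub : ∀ m n, α (m + n) ≤ α m + α n + 1) :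
    ∃ C : ℝ, 0 ≤ C ∧ Tendsto (fun n : ℕ => α n / n) atTop (𝓝 C) ∧
      ∀ n : ℕ, α n ≤ C * n ∧ C * n ≤ α n + 1 := by
  have h1 : Subadditive fun n => α n + 1 := fun m n => by linarith [hsub m n]
  -- Fekete for `α + 1` gives `C * n ≤ α n + 1`, and for `-α` it gives `α n ≤ C * n`.
  have h2 : Subadditive fun n => -α n := fun m n => by linarith [hsup m n]
  have hb1 : BddBelow (Set.range fun n : ℕ => (α n + 1) / n) :=
    ⟨0, by rintro _ ⟨n, rfl⟩; have := hα n; positivity⟩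
  have hlim1 := h1.tendsto_lim hb1
  have hle1 : ∀ n : ℕ, n ≠ 0 → h1.lim ≤ (α n + 1) / n := fun n hn => h1.lim_le_div hb1 hn
  generalize h1.lim = C at hlim1 hle1
  have hlim : Tendsto (fun n : ℕ => α n / n) atTop (𝓝 C) := by
    have := hlim1.sub tendsto_one_div_atTop_nhds_zero_nat
    rw [sub_zero] at this
    refine this.congr fun n => ?_
    rw [add_div, add_sub_cancel_right]
  have hgrow : ∀ n : ℕ, α n ≤ n * (α 1 + 1) := fun n => by
    induction n with
    | zero => have := hsup 0 0; simp at this ⊢; exact this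
    | succ n ih => have := hsub n 1; push_cast; linarith
  have hb2 : BddBelow (Set.range fun n : ℕ => -α n / n) := by
    refine ⟨-(α 1 + 1), ?_⟩
    rintro _ ⟨n, rfl⟩
    rcases Nat.eq_zero_or_pos n with rfl | hn
    · simp; linarith [hα 1]
    · have : (0 : ℝ) < n := by exact_mod_cast hn
      simp only
      rw [le_div_iff₀ this]
      linarith [hgrow n]
  have hlim2 : h2.lim = -C := by
    refine tendsto_nhds_unique (h2.tendsto_lim hb2) ?_
    simpa [neg_div] using hlim.neg
  refine ⟨C, ge_of_tendsto' hlim fun n => div_nonneg (hα n) n.cast_nonneg, hlim, fun n => ?_⟩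
  rcases Nat.eq_zero_or_pos n with rfl | hn
  · have := hsup 0 0
    simp at this ⊢
    exact ⟨this, by linarith [hα 0]⟩
  · have hn' : (0 : ℝ) < n := by exact_mod_cast hn
    refine ⟨?_, (le_div_iff₀ hn').1 (hle1 n hn.ne')⟩
    have := h2.lim_le_div hb2 hn.ne'
    rw [hlim2, le_div_iff₀ hn'] at this
    linarith

/-- Countably many sequences of functions that tend to zero in mean tend to zero almost
everywhere along a common subsequence. -/
theorem exists_strictMono_forall_ae_tendsto_zero {Ω ι : Type*} [MeasurableSpace Ω]
    {P : Measure Ω} [Countable ι] {f : ℕ → ι → Ω → ℝ≥0∞} (hf : ∀ n i, Measurable (f n i))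
    (h : ∀ i, Tendsto (fun n => ∫⁻ ω, f n i ω ∂P) atTop (𝓝 0)) :
    ∃ φ : ℕ → ℕ, StrictMono φ ∧
      ∀ᵐ ω ∂P, ∀ i, Tendsto (fun n => f (φ n) i ω) atTop (𝓝 0) := by
  rcases isEmpty_or_nonempty ι with hι | hι
  · exact ⟨id, strictMono_id, by simp⟩
  obtain ⟨e, he⟩ := exists_surjective_nat ι
  -- Diagonal choice: the `n`-th term controls the first `n + 1` indices with a geometric bound. The
  -- index numbered `m` is controlled only from term `m` on, hence the shift by `m` below.
  obtain ⟨φ, hφ, hφP⟩ := extraction_forall_of_eventually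
    (P := fun n j => ∀ i ∈ Finset.range (n + 1), ∫⁻ ω, f j (e i) ω ∂P ≤ 2⁻¹ ^ n) fun n =>
      (eventually_all_finset _).2 fun i _ =>
        ENNReal.tendsto_nhds_zero.1 (h (e i)) _ (ENNReal.pow_pos (by simp) n)
  refine ⟨φ, hφ, ae_all_iff.2 fun i => ?_⟩
  obtain ⟨m, rfl⟩ := he i
  have hsum : ∫⁻ ω, ∑' n, f (φ (n + m)) (e m) ω ∂P ≠ ⊤ := by
    rw [lintegral_tsum fun n => (hf _ _).aemeasurable]
    refine ne_top_of_le_ne_top (b := ∑' n : ℕ, (2⁻¹ : ℝ≥0∞) ^ n) ?_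
      (ENNReal.tsum_le_tsum fun n => ?_)
    · rw [ENNReal.tsum_geometric]
      simp
    · refine (hφP (n + m) m (by simp)).trans ?_
      exact pow_le_pow_right_of_le_one' (by simp) (Nat.le_add_right n m)
  filter_upwards [ae_lt_top (Measurable.tsum fun n => hf (φ (n + m)) (e m)) hsum] with ω hω
  exact (tendsto_add_atTop_iff_nat m).1 (ENNReal.tendsto_atTop_zero_of_tsum_ne_top hω.ne)

theorem NNReal.exists_nnrat_btwn {a b : ℝ≥0} (h : a < b) :
    ∃ q : ℚ≥0, a < (q : ℝ≥0) ∧ (q : ℝ≥0) < b := by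
  obtain ⟨q, hq0, h1, h2⟩ := (NNReal.lt_iff_exists_rat_btwn a b).1 h
  lift q to ℚ≥0 using hq0
  have : Real.toNNReal ((q : ℚ) : ℝ) = (q : ℝ≥0) := by
    ext
    rw [Real.coe_toNNReal _ (by positivity)]
    push_cast
    rfl
  exact ⟨q, this ▸ h1, this ▸ h2⟩

/-- Monotone functions converging at rational points to a linear function converge everywhere. -/
theorem tendsto_mul_of_tendsto_nnrat {f : ℕ → ℝ≥0 → ℝ≥0∞} (hf : ∀ n, Monotone (f n)) (C : ℝ)
    (hq : ∀ q : ℚ≥0, Tendsto (fun n => f n q) atTop (𝓝 (ENNReal.ofReal (C * (q : ℝ≥0)))))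
    (hC : 0 ≤ C) (t : ℝ≥0) :
    Tendsto (fun n => f n t) atTop (𝓝 (ENNReal.ofReal (C * t))) := by
  have hcont : Continuous fun s : ℝ≥0 => ENNReal.ofReal (C * s) :=
    ENNReal.continuous_ofReal.comp (continuous_const.mul NNReal.continuous_coe)
  have hmono : Monotone fun s : ℝ≥0 => ENNReal.ofReal (C * s) := fun s r hsr =>
    ENNReal.ofReal_le_ofReal (mul_le_mul_of_nonneg_left (by exact_mod_cast hsr) hC)
  refine tendsto_order.2 ⟨fun a ha => ?_, fun a ha => ?_⟩
  · have ht : 0 < t := by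
      rcases eq_or_ne t 0 with rfl | h
      · simp at ha
      · exact pos_iff_ne_zero.2 h
    -- A rational slightly below `t` has a limit still above `a`, and monotonicity transfers the
    -- bound to `t`; the upper bound is symmetric.
    have hev : ∀ᶠ s : ℝ≥0 in 𝓝[<] t, a < ENNReal.ofReal (C * s) :=
      (hcont.tendsto t).mono_left nhdsWithin_le_nhds |>.eventually (lt_mem_nhds ha)
    have : (𝓝[<] t).NeBot := nhdsLT_neBot_of_exists_lt ⟨0, ht⟩
    obtain ⟨s, hs, hst⟩ := (hev.and self_mem_nhdsWithin).exists
    obtain ⟨q, hsq, hqt⟩ := NNReal.exists_nnrat_btwn hst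
    filter_upwards [(tendsto_order.1 (hq q)).1 a (hs.trans_le (hmono hsq.le))] with n hn
    exact hn.trans_le (hf n hqt.le)
  · have hev : ∀ᶠ s : ℝ≥0 in 𝓝[>] t, ENNReal.ofReal (C * s) < a :=
      (hcont.tendsto t).mono_left nhdsWithin_le_nhds |>.eventually (gt_mem_nhds ha)
    obtain ⟨s, hs, hst⟩ := (hev.and self_mem_nhdsWithin).exists
    obtain ⟨q, htq, hqs⟩ := NNReal.exists_nnrat_btwn hst
    filter_upwards [(tendsto_order.1 (hq q)).2 a ((hmono hqs.le).trans_lt hs)] with n hn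
    exact (hf n htq.le).trans_lt hn

end RealAndFilter

/-! ### From shift-ergodicity to averages of random variables. -/

section ErgodicSequence

/-- Mean ergodic theorem for stationary ergodic sequences of non-negative random variables. -/
theorem IsErgodicSequence.tendsto_lintegral_ennDist_sum {Ω : Type*} [MeasurableSpace Ω]
    {P : Measure Ω} [IsProbabilityMeasure P] {Y : ℕ → Ω → ℝ≥0∞} (herg : IsErgodicSequence P Y)
    (hY : ∀ n, Measurable (Y n))
    (hstat : IdentDistrib (fun ω n => Y (n + 1) ω) (fun ω n => Y n ω) P P)
    (hfin : ∫⁻ ω, Y 0 ω ∂P ≠ ⊤) :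
    Tendsto (fun m : ℕ => (m : ℝ≥0∞)⁻¹ *
      ∫⁻ ω, ennDist (∑ i ∈ Finset.range m, Y i ω) (m * ∫⁻ ω, Y 0 ω ∂P) ∂P) atTop (𝓝 0) := by
  set T : (ℕ → ℝ≥0∞) → ℕ → ℝ≥0∞ := fun y n => y (n + 1) with hTdef
  have hYm : Measurable fun ω n => Y n ω := measurable_pi_lambda _ hY
  have hTm : Measurable T := by fun_prop
  set ν := P.map fun ω n => Y n ω with hν
  have : IsProbabilityMeasure ν := Measure.isProbabilityMeasure_map hYm.aemeasurable
  have hTν : ν.map T = ν := by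
    rw [hν, Measure.map_map hTm hYm]
    exact hstat.map_eq
  have hT : Ergodic T ν := { measurable := hTm, map_eq := hTν, toPreErgodic := herg }
  have hiter : ∀ i y n, T^[i] y n = y (n + i) := fun i => by
    induction i with
    | zero => simp
    | succ i ih =>
      intro y n
      rw [Function.iterate_succ_apply, ih]
      simp only [hTdef]
      ring_nf
  have hY0 : ∫⁻ y, y 0 ∂ν = ∫⁻ ω, Y 0 ω ∂P := lintegral_map (measurable_pi_apply 0) hYm
  have hfinν : ∫⁻ y, y 0 ∂ν ≠ ⊤ := by rwa [hY0]
  have hint : Integrable (fun y : ℕ → ℝ≥0∞ => (y 0).toReal) ν :=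
    integrable_toReal_of_lintegral_ne_top (measurable_pi_apply 0).aemeasurable hfinν
  -- Finite mean and shift invariance make all coordinates finite, so that `toReal` loses nothing.
  have htop : ∀ᵐ y ∂ν, ∀ i, y i < ⊤ := by
    refine ae_all_iff.2 fun i => ?_
    have h0 : ∀ᵐ y ∂ν, y 0 < ⊤ := ae_lt_top (measurable_pi_apply 0) hfinν
    have := (hT.toMeasurePreserving.iterate i).quasiMeasurePreserving.ae h0
    filter_upwards [this] with y hy
    simpa [hiter] using hy
  have hmean : ∫ y, (y 0).toReal ∂ν = (∫⁻ ω, Y 0 ω ∂P).toReal := by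
    rw [integral_toReal (measurable_pi_apply 0).aemeasurable
      (ae_lt_top (measurable_pi_apply 0) hfinν), hY0]
  refine (hT.tendsto_eLpNorm_birkhoffAverage hint).congr' ?_
  filter_upwards [eventually_ne_atTop 0] with m hm
  have hm' : (m : ℝ) ≠ 0 := by exact_mod_cast hm
  have hmeas : Measurable fun y : ℕ → ℝ≥0∞ =>
      ennDist (∑ i ∈ Finset.range m, y i) (m * ∫⁻ ω, Y 0 ω ∂P) :=
    Measurable.ennDist_const (by fun_prop) _
  rw [eLpNorm_one_eq_lintegral_enorm, hmean, birkhoffAverage_real_eq,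
    ← lintegral_map (μ := P) hmeas hYm, ← lintegral_const_mul _ hmeas]
  refine lintegral_congr_ae ?_
  filter_upwards [htop] with y hy
  rw [ennDist_eq_enorm (ENNReal.sum_lt_top.2 fun i _ => hy i).ne
    (ENNReal.mul_ne_top (by simp) hfin), ENNReal.toReal_sum fun i _ => (hy i).ne,
    ENNReal.toReal_mul, ENNReal.toReal_natCast]
  have : (m : ℝ≥0∞)⁻¹ = ‖(m : ℝ)⁻¹‖ₑ := by rw [enorm_inv hm', Real.enorm_natCast]
  rw [this, ← enorm_mul, mul_sub, inv_mul_cancel_left₀ hm']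
  simp [hiter]

end ErgodicSequence

/-! ### Measurability and invariance of laws. -/

section StationaryIncrements

theorem Fin.sum_filter_castSucc_lt_sub {n : ℕ} (f : Fin (n + 1) → ℝ) (j : Fin (n + 1)) :
    ∑ i : Fin n with i.castSucc < j, (f i.succ - f i.castSucc) = f j - f 0 := by
  induction j using Fin.induction with
  | zero => simp
  | succ j ih =>
    have : (Finset.univ.filter fun i : Fin n => i.castSucc < j.succ) =
        insert j (Finset.univ.filter fun i : Fin n => i.castSucc < j.castSucc) := by
      ext i
      simp [Fin.castSucc_lt_succ_iff, le_iff_eq_or_lt]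
    rw [this, Finset.sum_insert (by simp), ih]
    ring

variable {Ω : Type*} [MeasurableSpace Ω] {P : Measure Ω} {X : ℝ≥0 → Ω → ℝ}

/-- A process with stationary increments, re-started at time `h`, has the law of the process
started at time `0`. -/
theorem HasStationaryIncrementsProcess.identDistrib [IsProbabilityMeasure P]
    (hsi : HasStationaryIncrementsProcess P X) (hX : ∀ t, Measurable (X t)) (h : ℝ≥0) :
    IdentDistrib (fun ω t => X (t + h) ω - X h ω) (fun ω t => X t ω - X 0 ω) P P := by
  have hm : ∀ h, AEMeasurable (fun ω t => X (t + h) ω - X h ω) P := fun h =>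
    (measurable_pi_lambda _ fun t => (hX (t + h)).sub (hX h)).aemeasurable
  have hm0 : AEMeasurable (fun ω t => X t ω - X 0 ω) P := by simpa using hm 0
  rcases eq_or_ne h 0 with rfl | hh
  · simp only [add_zero]
    exact .refl hm0
  have hh : 0 < h := pos_iff_ne_zero.2 hh
  refine (identDistrib_iff_forall_finset_identDistrib (hm h) hm0).2 fun I => ?_
  -- Adjoining time 0 makes each `X a - X 0` a sum of consecutive increments along the sorted times,
  -- recovered by `φ` below.
  obtain ⟨n, hn⟩ : ∃ n, (insert 0 I).card = n + 1 :=
    Nat.exists_eq_succ_of_ne_zero (Finset.card_ne_zero_of_mem (Finset.mem_insert_self 0 I))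
  let t := (insert 0 I).orderEmbOfFin hn
  have hmem : ∀ a ∈ insert 0 I, ∃ j, t j = a := fun a ha => by
    have : a ∈ Set.range t := by
      rw [Finset.range_orderEmbOfFin]
      exact_mod_cast ha
    exact this
  have ht0 : t 0 = 0 := by
    obtain ⟨j, hj⟩ := hmem 0 (Finset.mem_insert_self 0 I)
    exact le_antisymm (hj ▸ t.monotone (Fin.zero_le j)) zero_le
  choose! idx hidx using hmem
  let φ : (Fin n → ℝ) → I → ℝ := fun v a => ∑ i : Fin n with i.castSucc < idx a, v i
  have hφ : Measurable φ := by fun_prop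
  have := (hsi n t t.strictMono h hh).comp hφ
  convert this.symm using 1
  · ext ω a
    have ha := hidx a (Finset.mem_insert_of_mem a.2)
    have := Fin.sum_filter_castSucc_lt_sub (fun i => X (t i + h) ω) (idx a)
    simp only [ha, ht0, zero_add] at this
    simp [φ, this]
  · ext ω a
    have ha := hidx a (Finset.mem_insert_of_mem a.2)
    have := Fin.sum_filter_castSucc_lt_sub (fun i => X (t i) ω) (idx a)
    simp only [ha, ht0] at this
    simp [φ, this]

theorem measurable_truncVar_process (hX : ∀ t, Measurable (X t))
    (hrc : ∀ ω t, ContinuousWithinAt (fun t => X t ω) (Set.Ici t) t) {c : ℝ} (hc : 0 ≤ c)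
    (s t : ℝ≥0) : Measurable fun ω => truncVar (fun r => X r ω) c s t := by
  rcases lt_trichotomy s t with hst | rfl | hst
  · have h : (fun ω => truncVar (fun r => X r ω) c s t) =
        fun ω => ratTruncVar (fun r => X r ω) c s t :=
      funext fun ω => truncVar_eq_ratTruncVar (hrc ω) c hst
    have hm : Measurable fun ω r => X r ω := measurable_pi_lambda _ hX
    have hG := (measurable_ratTruncVar c s t).comp hm
    rw [h]
    exact hG
  · simp only [truncVar_self _ hc, measurable_const]
  · simp only [truncVar_of_lt _ c hst, measurable_const]

theorem ContinuousWithinAt.comp_add_right_sub_const {x : ℝ≥0 → ℝ}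
    (hx : ∀ t, ContinuousWithinAt x (Set.Ici t) t) (h : ℝ≥0) (b : ℝ) (t : ℝ≥0) :
    ContinuousWithinAt (fun r => x (r + h) - b) (Set.Ici t) t :=
  ((hx (t + h)).comp (t := Set.Ici (t + h)) (f := fun r => r + h) (by fun_prop)
    fun _ hr => add_le_add_left (Set.mem_Ici.1 hr) h).sub continuousWithinAt_const

theorem ContinuousWithinAt.const_mul_comp_mul_left {x : ℝ≥0 → ℝ}
    (hx : ∀ t, ContinuousWithinAt x (Set.Ici t) t) (a : ℝ) (A t : ℝ≥0) :
    ContinuousWithinAt (fun r => a * x (A * r)) (Set.Ici t) t :=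
  continuousWithinAt_const.mul ((hx (A * t)).comp (t := Set.Ici (A * t)) (f := fun r => A * r)
    (by fun_prop) fun _ hr => mul_le_mul_right (Set.mem_Ici.1 hr) A)

/-- The truncated variations over a family of intervals have the same joint law as those over the
shifted intervals. -/
theorem HasStationaryIncrementsProcess.identDistrib_truncVar [IsProbabilityMeasure P]
    (hsi : HasStationaryIncrementsProcess P X) (hX : ∀ t, Measurable (X t))
    (hrc : ∀ ω t, ContinuousWithinAt (fun t => X t ω) (Set.Ici t) t) (c : ℝ) {ι : Type*}
    {s t : ι → ℝ≥0} (hst : ∀ i, s i < t i) (h : ℝ≥0) :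
    IdentDistrib (fun ω i => truncVar (fun r => X r ω) c (s i + h) (t i + h))
      (fun ω i => truncVar (fun r => X r ω) c (s i) (t i)) P P := by
  -- The countable supremum is measurable for the product σ-algebra, so equality of laws transfers;
  -- right-continuity then restores the full supremum on both sides.
  have hG : Measurable fun (x : ℝ≥0 → ℝ) i => ratTruncVar x c (s i) (t i) :=
    measurable_pi_lambda _ fun i => measurable_ratTruncVar c (s i) (t i)
  convert (hsi.identDistrib hX h).comp hG using 1
  · ext ω i
    rw [← truncVar_add_const_comp_add _ c (X h ω), truncVar_eq_ratTruncVar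
      (ContinuousWithinAt.comp_add_right_sub_const (hrc ω) h _) c (hst i)]
    rfl
  · ext ω i
    have h0 := truncVar_add_const_comp_add (fun r => X r ω) c (X 0 ω) 0 (s i) (t i)
    rw [add_zero, add_zero] at h0
    rw [← h0, truncVar_eq_ratTruncVar
      (ContinuousWithinAt.comp_add_right_sub_const (hrc ω) 0 _) c (hst i)]
    simp

theorem HasStationaryIncrementsProcess.lintegral_truncVar [IsProbabilityMeasure P]
    (hsi : HasStationaryIncrementsProcess P X) (hX : ∀ t, Measurable (X t))
    (hrc : ∀ ω t, ContinuousWithinAt (fun t => X t ω) (Set.Ici t) t) {c : ℝ} (hc : 0 ≤ c)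
    {s t : ℝ≥0} (hst : s ≤ t) (h : ℝ≥0) :
    ∫⁻ ω, truncVar (fun r => X r ω) c (s + h) (t + h) ∂P =
      ∫⁻ ω, truncVar (fun r => X r ω) c s t ∂P := by
  rcases hst.eq_or_lt with rfl | hst
  · simp [truncVar_self _ hc]
  · exact ((hsi.identDistrib_truncVar hX hrc c (fun _ : Unit => hst) h).comp
      (measurable_pi_apply ())).lintegral_eq

/-- Scaling of the law of the truncated variation of a self-similar process. -/
theorem IsSelfSimilarProcess.lintegral_comp_truncVar {β : ℝ} (hss : IsSelfSimilarProcess P X β)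
    (hrc : ∀ ω t, ContinuousWithinAt (fun t => X t ω) (Set.Ici t) t) {c : ℝ} (hc : 0 ≤ c)
    {A : ℝ≥0} (hA : 0 < A) (s t : ℝ≥0) {F : ℝ≥0∞ → ℝ≥0∞} (hF : Measurable F) :
    ∫⁻ ω, F (truncVar (fun r => X r ω) c s t) ∂P =
      ∫⁻ ω, F (ENNReal.ofReal ((A : ℝ) ^ (-β)) *
        truncVar (fun r => X r ω) ((A : ℝ) ^ β * c) (A * s) (A * t)) ∂P := by
  have ha : (0 : ℝ) < (A : ℝ) ^ (-β) := Real.rpow_pos_of_pos (by exact_mod_cast hA) _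
  have hac : (A : ℝ) ^ (-β) * ((A : ℝ) ^ β * c) = c := by
    rw [← mul_assoc, ← Real.rpow_add (by exact_mod_cast hA)]
    simp
  have hAc : 0 ≤ (A : ℝ) ^ β * c := by positivity
  rcases lt_trichotomy s t with hst | rfl | hst
  · have := ((hss A hA).comp (hF.comp (measurable_ratTruncVar c s t))).lintegral_eq
    simp only [Function.comp_apply] at this
    calc ∫⁻ ω, F (truncVar (fun r => X r ω) c s t) ∂P
        = ∫⁻ ω, F (ratTruncVar (fun r => X r ω) c s t) ∂P :=
          lintegral_congr fun ω => by rw [truncVar_eq_ratTruncVar (hrc ω) c hst]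
      _ = ∫⁻ ω, F (ratTruncVar (fun r => (A : ℝ) ^ (-β) * X (A * r) ω) c s t) ∂P := this.symm
      _ = _ := by
          refine lintegral_congr fun ω => ?_
          rw [← truncVar_scale (fun r => X r ω) _ ha hA, hac, truncVar_eq_ratTruncVar
            (ContinuousWithinAt.const_mul_comp_mul_left (hrc ω) _ A) c hst]
  · simp [truncVar_self _ hc, truncVar_self _ hAc]
  · simp [truncVar_of_lt _ _ hst, truncVar_of_lt _ _ ((mul_lt_mul_iff_right₀ hA).2 hst)]

end StationaryIncrements

/-! ### Linear growth of the mean and convergence in mean. -/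

section SelfSimilarStationaryIncrements

variable {Ω : Type*} [MeasurableSpace Ω] {P : Measure Ω} [IsProbabilityMeasure P]
  {X : ℝ≥0 → Ω → ℝ} {β : ℝ}

theorem HasStationaryIncrementsProcess.lintegral_truncVar_le_mul
    (hsi : HasStationaryIncrementsProcess P X) (hX : ∀ t, Measurable (X t))
    (hrc : ∀ ω t, ContinuousWithinAt (fun t => X t ω) (Set.Ici t) t) {c : ℝ} (hc : 0 ≤ c)
    (h : ℝ≥0) (m : ℕ) :
    ∫⁻ ω, truncVar (fun r => X r ω) c 0 (m * h) ∂P ≤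
      m * ∫⁻ ω, truncVar (fun r => X r ω) c 0 h ∂P + m * ENNReal.ofReal c := by
  have hmono : Monotone fun i : ℕ => (i : ℝ≥0) * h := fun i j hij => by
    have : (i : ℝ≥0) ≤ j := by exact_mod_cast hij
    simp only
    gcongr
  have hm := fun i : ℕ => measurable_truncVar_process hX hrc hc (i * h) ((i + 1 : ℕ) * h)
  have hblock : ∀ i : ℕ, ∫⁻ ω, truncVar (fun r => X r ω) c (i * h) ((i + 1 : ℕ) * h) ∂P =
      ∫⁻ ω, truncVar (fun r => X r ω) c 0 h ∂P := fun i => by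
    rw [← hsi.lintegral_truncVar hX hrc hc (zero_le (a := h)) (i * h)]
    push_cast
    ring_nf
  calc _ ≤ ∫⁻ ω, (∑ i ∈ Finset.range m,
          truncVar (fun r => X r ω) c (i * h) ((i + 1 : ℕ) * h) + m * ENNReal.ofReal c) ∂P := by
        refine lintegral_mono fun ω => ?_
        simpa using truncVar_le_sum_add (fun r => X r ω) hc hmono m
    _ = _ := by
        rw [lintegral_add_right _ measurable_const, lintegral_finsetSum _ fun i _ => hm i,
          Finset.sum_congr rfl fun i _ => hblock i]
        simp

theorem lintegral_truncVar_one_ne_top (hX : ∀ t, Measurable (X t))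
    (hrc : ∀ ω t, ContinuousWithinAt (fun t => X t ω) (Set.Ici t) t)
    (hβ : 0 < β) (hss : IsSelfSimilarProcess P X β) (hsi : HasStationaryIncrementsProcess P X)
    (hfin : ∃ c₀ : ℝ, 0 < c₀ ∧ ∫⁻ ω, truncVar (fun t => X t ω) c₀ 0 1 ∂P < ∞) (t : ℝ≥0) :
    ∫⁻ ω, truncVar (fun r => X r ω) 1 0 t ∂P ≠ ⊤ := by
  obtain ⟨c₀, hc₀, hfin⟩ := hfin
  -- Chosen so that `A ^ β * c₀ = 1`: finiteness at level `c₀` on `[0, 1]` becomes finiteness at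
  -- level 1 on `[0, A]`, then on any `[0, m * A]`.
  set A : ℝ≥0 := ⟨c₀ ^ (-β⁻¹), by positivity⟩ with hAdef
  have hAc : (A : ℝ) = c₀ ^ (-β⁻¹) := rfl
  have hA : 0 < A := by
    rw [← NNReal.coe_pos, hAc]
    positivity
  have h1 : (A : ℝ) ^ β * c₀ = 1 := by
    rw [hAc, ← Real.rpow_mul hc₀.le, neg_mul, inv_mul_cancel₀ hβ.ne', Real.rpow_neg_one,
      inv_mul_cancel₀ hc₀.ne']
  have hA' : (0 : ℝ) < (A : ℝ) ^ (-β) := Real.rpow_pos_of_pos (by exact_mod_cast hA) _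
  have hscale := hss.lintegral_comp_truncVar hrc hc₀.le hA 0 1 measurable_id
  simp only [id_eq, h1, mul_zero, mul_one] at hscale
  rw [hscale, lintegral_const_mul _ (measurable_truncVar_process hX hrc zero_le_one 0 A)] at hfin
  have hfinA : ∫⁻ ω, truncVar (fun r => X r ω) 1 0 A ∂P ≠ ⊤ := fun h => by
    rw [h, ENNReal.mul_top (by simpa using hA')] at hfin
    exact lt_irrefl _ hfin
  obtain ⟨m, hm⟩ := exists_nat_ge (t / A)
  have htm : t ≤ m * A := (div_le_iff₀ hA).1 hm
  refine ne_top_of_le_ne_top ?_ ((lintegral_mono fun ω =>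
    truncVar_mono_right (fun r => X r ω) 1 zero_le htm).trans
      (hsi.lintegral_truncVar_le_mul hX hrc zero_le_one A m))
  exact ENNReal.add_ne_top.2 ⟨ENNReal.mul_ne_top (by simp) hfinA, ENNReal.mul_ne_top (by simp)
    (by simp)⟩

/-- The mean truncated variation grows linearly, up to a bounded error. -/
theorem exists_tendsto_lintegral_truncVar_div (hX : ∀ t, Measurable (X t))
    (hrc : ∀ ω t, ContinuousWithinAt (fun t => X t ω) (Set.Ici t) t)
    (hsi : HasStationaryIncrementsProcess P X)
    (hfin : ∀ n : ℕ, ∫⁻ ω, truncVar (fun r => X r ω) 1 0 n ∂P ≠ ⊤) :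
    ∃ C : ℝ, 0 ≤ C ∧
      Tendsto (fun n : ℕ => (∫⁻ ω, truncVar (fun t => X t ω) 1 0 (n : ℝ≥0) ∂P) / (n : ℝ≥0∞))
        atTop (𝓝 (ENNReal.ofReal C)) ∧
      ∀ n : ℕ, ∫⁻ ω, truncVar (fun t => X t ω) 1 0 (n : ℝ≥0) ∂P ≤ ENNReal.ofReal (C * n) ∧
        ENNReal.ofReal (C * n) ≤ ∫⁻ ω, truncVar (fun t => X t ω) 1 0 (n : ℝ≥0) ∂P + 1 := by
  have hm := fun s t : ℝ≥0 => measurable_truncVar_process hX hrc zero_le_one s t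
  have hshift : ∀ m n : ℕ, ∫⁻ ω, truncVar (fun r => X r ω) 1 m (m + n : ℕ) ∂P =
      ∫⁻ ω, truncVar (fun r => X r ω) 1 0 n ∂P := fun m n => by
    rw [← hsi.lintegral_truncVar hX hrc zero_le_one (zero_le (a := (n : ℝ≥0))) m]
    push_cast
    rw [zero_add, add_comm]
  have hle : ∀ m n : ℕ, (m : ℝ≥0) ≤ (m + n : ℕ) := fun m n => by simp
  set a : ℕ → ℝ≥0∞ := fun n => ∫⁻ ω, truncVar (fun r => X r ω) 1 0 n ∂P with ha
  have hsup : ∀ m n, a m + a n ≤ a (m + n) := fun m n => by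
    simp only [ha]
    rw [← hshift m n, ← lintegral_add_left (hm 0 m)]
    exact lintegral_mono fun ω => truncVar_add_truncVar_le _ 1 zero_le (hle m n)
  have hsub : ∀ m n, a (m + n) ≤ a m + a n + 1 := fun m n => by
    have : (1 : ℝ≥0∞) = ∫⁻ _, 1 ∂P := by simp
    simp only [ha]
    rw [← hshift m n, ← lintegral_add_left (hm 0 m), this,
      ← lintegral_add_right _ measurable_const]
    refine lintegral_mono fun ω => ?_
    simpa using truncVar_le_add_add (fun r => X r ω) (c := 1) zero_le (hle m n)
  obtain ⟨C, hC, hlim, hbd⟩ := exists_tendsto_div_of_almost_additive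
    (α := fun n => (a n).toReal) (fun n => ENNReal.toReal_nonneg)
    (fun m n => by
      rw [← ENNReal.toReal_add (hfin m) (hfin n)]
      exact ENNReal.toReal_mono (hfin (m + n)) (hsup m n))
    (fun m n => by
      have hne : a m + a n ≠ ⊤ := ENNReal.add_ne_top.2 ⟨hfin m, hfin n⟩
      have := ENNReal.toReal_mono (ENNReal.add_ne_top.2 ⟨hne, ENNReal.one_ne_top⟩) (hsub m n)
      rwa [ENNReal.toReal_add hne ENNReal.one_ne_top, ENNReal.toReal_add (hfin m) (hfin n),
        ENNReal.toReal_one] at this)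
  refine ⟨C, hC, ?_, fun n => ⟨?_, ?_⟩⟩
  · refine (ENNReal.tendsto_ofReal hlim).congr' ?_
    filter_upwards [eventually_gt_atTop 0] with n hn
    rw [ENNReal.ofReal_div_of_pos (by exact_mod_cast hn), ENNReal.ofReal_toReal (hfin n),
      ENNReal.ofReal_natCast]
  · exact (ENNReal.le_ofReal_iff_toReal_le (hfin n) (by positivity)).2 (hbd n).1
  · refine ENNReal.ofReal_le_of_le_toReal ((hbd n).2.trans_eq ?_)
    rw [ENNReal.toReal_add (hfin n) ENNReal.one_ne_top, ENNReal.toReal_one]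

/-- Along multiples of `k`, the truncated variation is within `3 m` of its linear growth in mean
at time `m k`. -/
theorem eventually_lintegral_ennDist_truncVar_le (hX : ∀ t, Measurable (X t))
    (hrc : ∀ ω t, ContinuousWithinAt (fun t => X t ω) (Set.Ici t) t)
    (hsi : HasStationaryIncrementsProcess P X)
    (hfin : ∀ n : ℕ, ∫⁻ ω, truncVar (fun r => X r ω) 1 0 n ∂P ≠ ⊤) {C : ℝ}
    (hgrowth : ∀ n : ℕ, ∫⁻ ω, truncVar (fun t => X t ω) 1 0 (n : ℝ≥0) ∂P ≤ ENNReal.ofReal (C * n) ∧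
        ENNReal.ofReal (C * n) ≤ ∫⁻ ω, truncVar (fun t => X t ω) 1 0 (n : ℝ≥0) ∂P + 1)
    {k : ℕ} (hk : 0 < k)
    (herg : IsErgodicSequence P (fun (n : ℕ) ω =>
        truncVar (fun t => X t ω) 1 ((n * k : ℕ) : ℝ≥0) (((n + 1) * k : ℕ) : ℝ≥0))) :
    ∀ᶠ m : ℕ in atTop, ∫⁻ ω, ennDist (truncVar (fun t => X t ω) 1 0 ((m * k : ℕ) : ℝ≥0))
      (ENNReal.ofReal (C * (m * k : ℕ))) ∂P ≤ 3 * m := by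
  set Y : ℕ → Ω → ℝ≥0∞ := fun n ω =>
    truncVar (fun t => X t ω) 1 ((n * k : ℕ) : ℝ≥0) (((n + 1) * k : ℕ) : ℝ≥0) with hYdef
  have hY : ∀ n, Measurable (Y n) := fun n => measurable_truncVar_process hX hrc zero_le_one _ _
  have hmono : Monotone fun i : ℕ => ((i * k : ℕ) : ℝ≥0) := fun i j hij => by
    simp only
    exact_mod_cast Nat.mul_le_mul_right k hij
  have hstat : IdentDistrib (fun ω n => Y (n + 1) ω) (fun ω n => Y n ω) P P := by
    have := hsi.identDistrib_truncVar hX hrc 1 (s := fun n : ℕ => ((n * k : ℕ) : ℝ≥0))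
      (t := fun n : ℕ => (((n + 1) * k : ℕ) : ℝ≥0))
      (fun n => by exact_mod_cast Nat.mul_lt_mul_of_pos_right (Nat.lt_succ_self n) hk) k
    convert this using 4 with ω n
    · push_cast; ring
    · push_cast; ring
  have hY0 : ∫⁻ ω, Y 0 ω ∂P = ∫⁻ ω, truncVar (fun t => X t ω) 1 0 (k : ℝ≥0) ∂P := by
    simp [hYdef]
  have hlim := herg.tendsto_lintegral_ennDist_sum hY hstat (by rw [hY0]; exact hfin k)
  rw [hY0] at hlim
  set a := ∫⁻ ω, truncVar (fun t => X t ω) 1 0 (k : ℝ≥0) ∂P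
  -- An ergodic error of 1 per block suffices, as the other two errors are of that order too.
  filter_upwards [ENNReal.tendsto_nhds_zero.1 hlim 1 one_pos, eventually_ne_atTop 0]
    with m hm hm0
  have hm0' : (m : ℝ≥0∞) ≠ 0 := by exact_mod_cast hm0
  have h2 : ∫⁻ ω, ennDist (∑ i ∈ Finset.range m, Y i ω) (m * a) ∂P ≤ m := by
    have := mul_le_mul_right hm (m : ℝ≥0∞)
    rwa [← mul_assoc, ENNReal.mul_inv_cancel hm0' (by simp), one_mul, mul_one] at this
  have h3 : ennDist (m * a) (ENNReal.ofReal (C * (m * k : ℕ))) ≤ m := by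
    have : ENNReal.ofReal (C * (m * k : ℕ)) = m * ENNReal.ofReal (C * k) := by
      rw [← ENNReal.ofReal_natCast m, ← ENNReal.ofReal_mul m.cast_nonneg]
      push_cast
      ring_nf
    rw [this, ennDist_mul_left (by simp)]
    refine (mul_le_mul_right (ennDist_le_of_le_of_le_add (hgrowth k).1 (hgrowth k).2) _).trans ?_
    rw [mul_one]
  have h1 : ∀ ω, ennDist (truncVar (fun t => X t ω) 1 0 ((m * k : ℕ) : ℝ≥0))
      (∑ i ∈ Finset.range m, Y i ω) ≤ m := fun ω => by
    rw [ennDist_comm]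
    refine ennDist_le_of_le_of_le_add ?_ ?_
    · simpa [hYdef] using sum_truncVar_le (fun t => X t ω) 1 hmono m
    · simpa [hYdef] using truncVar_le_sum_add (fun t => X t ω) zero_le_one hmono m
  have hmeas : Measurable fun ω => ennDist (∑ i ∈ Finset.range m, Y i ω) (m * a) :=
    Measurable.ennDist_const (Finset.measurable_fun_sum _ fun i _ => hY i) _
  calc _ ≤ ∫⁻ ω, ((m : ℝ≥0∞) + ennDist (∑ i ∈ Finset.range m, Y i ω) (m * a) + m) ∂P := by
        refine lintegral_mono fun ω => ?_
        refine (ennDist_triangle _ (m * a) _).trans (add_le_add ?_ h3)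
        exact (ennDist_triangle _ _ _).trans (add_le_add_left (h1 ω) _)
    _ ≤ m + m + m := by
        rw [lintegral_add_right _ measurable_const, lintegral_add_left measurable_const]
        simp only [lintegral_const, measure_univ, mul_one]
        gcongr
    _ = 3 * m := by ring

/-- Convergence in mean of the normalized truncated variation along truncation levels
`(j !) ^ (-β)`, at rational times. -/
theorem tendsto_lintegral_ennDist_truncVar_factorial
    (hX : ∀ t, Measurable (X t))
    (hrc : ∀ ω t, ContinuousWithinAt (fun t => X t ω) (Set.Ici t) t)
    (hβ : 0 < β) (hss : IsSelfSimilarProcess P X β) {C : ℝ}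
    (hmean : ∀ k : ℕ, 0 < k → ∀ᶠ m : ℕ in atTop,
      ∫⁻ ω, ennDist (truncVar (fun t => X t ω) 1 0 ((m * k : ℕ) : ℝ≥0))
        (ENNReal.ofReal (C * (m * k : ℕ))) ∂P ≤ 3 * m) (q : ℚ≥0) :
    Tendsto (fun j : ℕ => ∫⁻ ω, ennDist
      (ENNReal.ofReal (((j.factorial : ℝ) ^ (-β)) ^ (1 / β - 1)) *
        truncVar (fun r => X r ω) ((j.factorial : ℝ) ^ (-β)) 0 (q : ℝ≥0))
      (ENNReal.ofReal (C * (q : ℝ≥0))) ∂P) atTop (𝓝 0) := by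
  rcases eq_or_ne q 0 with rfl | hq
  · have : ∀ j : ℕ, (0 : ℝ) ≤ (j.factorial : ℝ) ^ (-β) := fun j => by positivity
    simp [truncVar_self _ (this _), ennDist]
  have hnum : 0 < q.num := pos_iff_ne_zero.2 (by simpa using hq)
  refine ENNReal.tendsto_nhds_zero.2 fun ε hε => ?_
  -- After division by `A = m * k / q`, the error `3 * m` becomes `3 * q / k`.
  obtain ⟨k, hk0, hk⟩ : ∃ k : ℕ, 0 < k ∧ 3 * ENNReal.ofReal (q : ℝ) / k ≤ ε := by
    have := ENNReal.Tendsto.const_div (a := 3 * ENNReal.ofReal (q : ℝ))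
      ENNReal.tendsto_nat_nhds_top (Or.inr (ENNReal.mul_ne_top (by simp) (by simp)))
    rw [ENNReal.div_top] at this
    exact ((eventually_gt_atTop 0).and (ENNReal.tendsto_nhds_zero.1 this ε hε)).exists
  obtain ⟨M, hM⟩ := eventually_atTop.1 (hmean k hk0)
  filter_upwards [eventually_ge_atTop (q.den * k * (M + 1))] with j hj
  -- The factor `q.den` makes `j ! * q` an integer, `k` makes it a multiple of `k`, and `M + 1`
  -- makes the quotient `m` at least `M`.
  obtain ⟨d, hd⟩ : q.den * k * (M + 1) ∣ j.factorial :=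
    Nat.dvd_factorial (by have := q.den_pos; positivity) hj
  have hd0 : 0 < d := by
    rcases Nat.eq_zero_or_pos d with rfl | h
    · exact absurd hd (by simpa using j.factorial_ne_zero)
    · exact h
  set m := (M + 1) * d * q.num with hmdef
  have hMm : M ≤ m := by
    calc M ≤ M + 1 := Nat.le_succ M
      _ ≤ (M + 1) * (d * q.num) := Nat.le_mul_of_pos_right _ (by positivity)
      _ = m := by rw [hmdef, mul_assoc]
  set A : ℝ≥0 := (j.factorial : ℝ≥0) with hAdef
  have hA : 0 < A := by
    rw [hAdef]
    exact_mod_cast j.factorial_pos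
  have hA' : (0 : ℝ) < A := by exact_mod_cast hA
  have hAR : (j.factorial : ℝ) = (A : ℝ) := by simp [hAdef]
  have hAq : A * (q : ℝ≥0) = (m * k : ℕ) := by
    have hqd : (q : ℝ≥0) * q.den = q.num := by exact_mod_cast NNRat.mul_den_eq_num q
    rw [hAdef, hd, hmdef]
    push_cast
    rw [← hqd]
    ring
  have hc0 : (0 : ℝ) ≤ (A : ℝ) ^ (-β) := by positivity
  have hone : (A : ℝ) ^ β * (A : ℝ) ^ (-β) = 1 := by
    rw [← Real.rpow_add hA']; simp
  have hcoef : ((A : ℝ) ^ (-β)) ^ (1 / β - 1) * (A : ℝ) ^ (-β) = (A : ℝ)⁻¹ := by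
    rw [← Real.rpow_mul hA'.le, ← Real.rpow_add hA', ← Real.rpow_neg_one]
    congr 1
    field_simp
    ring
  have hmeas : Measurable fun v : ℝ≥0∞ => ennDist
      (ENNReal.ofReal (((A : ℝ) ^ (-β)) ^ (1 / β - 1)) * v)
      (ENNReal.ofReal (C * (q : ℝ≥0))) := (measurable_id.const_mul _).ennDist_const _
  have hCq : ENNReal.ofReal (C * (q : ℝ≥0)) =
      ENNReal.ofReal (A : ℝ)⁻¹ * ENNReal.ofReal (C * (m * k : ℕ)) := by
    have : ((m * k : ℕ) : ℝ) = (A : ℝ) * ((q : ℝ≥0) : ℝ) := by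
      rw [← NNReal.coe_mul, hAq, NNReal.coe_natCast]
    rw [← ENNReal.ofReal_mul (by positivity), this]
    congr 1
    field_simp
  rw [hAR, hss.lintegral_comp_truncVar hrc hc0 hA 0 q hmeas]
  simp only [hone, mul_zero, ← mul_assoc, hAq]
  rw [← ENNReal.ofReal_mul (by positivity), hcoef, hCq]
  simp only [ennDist_mul_left ENNReal.ofReal_ne_top]
  rw [lintegral_const_mul _ ((measurable_truncVar_process hX hrc zero_le_one _ _).ennDist_const _)]
  refine (mul_le_mul_right (hM m hMm) _).trans (le_trans (le_of_eq ?_) hk)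
  have hk' : (0 : ℝ) < k := by exact_mod_cast hk0
  have : (3 : ℝ≥0∞) = ENNReal.ofReal 3 := by simp
  rw [this, ← ENNReal.ofReal_natCast m, ← ENNReal.ofReal_natCast k, ← ENNReal.ofReal_mul (by simp),
    ← ENNReal.ofReal_mul (by positivity), ← ENNReal.ofReal_mul (by simp),
    ← ENNReal.ofReal_div_of_pos hk']
  congr 1
  have : (A : ℝ) * (q : ℝ) = m * k := by
    have := congrArg NNReal.toReal hAq
    rw [NNReal.coe_mul, NNReal.coe_natCast, Nat.cast_mul] at this
    exact this
  field_simp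
  linarith

end SelfSimilarStationaryIncrements

/-! ### The case of zero growth. -/

section Degenerate

variable {Ω : Type*} [MeasurableSpace Ω] {P : Measure Ω} [IsProbabilityMeasure P]
  {X : ℝ≥0 → Ω → ℝ} {β : ℝ}

theorem tendsto_natCast_succ_rpow_neg (hβ : 0 < β) :
    Tendsto (fun n : ℕ => ((n + 1 : ℕ) : ℝ) ^ (-β)) atTop (𝓝 0) :=
  (tendsto_rpow_neg_atTop hβ).comp
    (tendsto_natCast_atTop_atTop.comp (tendsto_add_atTop_nat 1))

/-- Time 0 is fixed by scaling, so `X 0` has the law of `A ^ (-β) * X 0`, which tends to 0 as `A`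
grows; the cut-off at 1 permits dominated convergence. -/
theorem IsSelfSimilarProcess.ae_apply_zero_eq_zero (hss : IsSelfSimilarProcess P X β)
    (hX : ∀ t, Measurable (X t)) (hβ : 0 < β) : ∀ᵐ ω ∂P, X 0 ω = 0 := by
  have hF : Measurable fun x : ℝ≥0 → ℝ => min 1 ‖x 0‖ₑ := by fun_prop
  have hlaw : ∀ n : ℕ, ∫⁻ ω, min 1 ‖((n + 1 : ℕ) : ℝ) ^ (-β) * X 0 ω‖ₑ ∂P =
      ∫⁻ ω, min 1 ‖X 0 ω‖ₑ ∂P := fun n => by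
    have := ((hss (n + 1 : ℕ) (by positivity)).comp hF).lintegral_eq
    simpa using this
  have hlim : Tendsto (fun n : ℕ => ∫⁻ ω, min 1 ‖((n + 1 : ℕ) : ℝ) ^ (-β) * X 0 ω‖ₑ ∂P) atTop
      (𝓝 (∫⁻ _, 0 ∂P)) := by
    refine tendsto_lintegral_of_dominated_convergence (fun _ => 1) (fun n => ?_)
      (fun n => ae_of_all _ fun ω => min_le_left _ _) (by simp) (ae_of_all _ fun ω => ?_)
    · exact measurable_const.min ((hX 0).const_mul _).enorm
    · have h1 : Tendsto (fun n : ℕ => ‖((n + 1 : ℕ) : ℝ) ^ (-β) * X 0 ω‖ₑ) atTop (𝓝 0) := by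
        have := ((tendsto_natCast_succ_rpow_neg hβ).mul_const (X 0 ω)).enorm
        simpa using this
      simpa using (tendsto_const_nhds (x := (1 : ℝ≥0∞))).min h1
  simp only [hlaw, lintegral_zero] at hlim
  have h0 := tendsto_nhds_unique tendsto_const_nhds hlim
  rw [lintegral_eq_zero_iff (measurable_const.min (hX 0).enorm)] at h0
  filter_upwards [h0] with ω hω
  have h : X 0 ω = 0 ∧ ‖X 0 ω‖ₑ ≤ 1 := by simpa [min_eq_iff] using hω
  exact h.1

/-- Scaling by `m + 1` gives zero variation at level `(m + 1) ^ (-β)`, so no increment from time 0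
exceeds that level, for any `m`. -/
theorem IsSelfSimilarProcess.ae_forall_eq_zero (hss : IsSelfSimilarProcess P X β)
    (hX : ∀ t, Measurable (X t))
    (hrc : ∀ ω t, ContinuousWithinAt (fun t => X t ω) (Set.Ici t) t) (hβ : 0 < β)
    (hzero : ∀ n : ℕ, ∫⁻ ω, truncVar (fun r => X r ω) 1 0 n ∂P = 0) :
    ∀ᵐ ω ∂P, ∀ t, X t ω = 0 := by
  have hc : ∀ m : ℕ, (0 : ℝ) ≤ ((m + 1 : ℕ) : ℝ) ^ (-β) := fun m => by positivity
  have hint : ∀ m n : ℕ,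
      ∫⁻ ω, truncVar (fun r => X r ω) (((m + 1 : ℕ) : ℝ) ^ (-β)) 0 n ∂P = 0 := fun m n => by
    have hA : (0 : ℝ≥0) < (m + 1 : ℕ) := by positivity
    have h := hss.lintegral_comp_truncVar hrc (hc m) hA 0 n measurable_id
    have hone : (((m + 1 : ℕ) : ℝ≥0) : ℝ) ^ β * ((m + 1 : ℕ) : ℝ) ^ (-β) = 1 := by
      rw [NNReal.coe_natCast, ← Real.rpow_add (by positivity)]
      simp
    have hmn : ((m + 1 : ℕ) : ℝ≥0) * (n : ℝ≥0) = ((m + 1) * n : ℕ) := by push_cast; ring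
    simp only [id_eq, hone, mul_zero, hmn] at h
    rw [h, lintegral_const_mul _ (measurable_truncVar_process hX hrc zero_le_one _ _), hzero,
      mul_zero]
  have hae : ∀ᵐ ω ∂P, ∀ m n : ℕ,
      truncVar (fun r => X r ω) (((m + 1 : ℕ) : ℝ) ^ (-β)) 0 n = 0 :=
    ae_all_iff.2 fun m => ae_all_iff.2 fun n =>
      (lintegral_eq_zero_iff (measurable_truncVar_process hX hrc (hc m) 0 n)).1 (hint m n)
  filter_upwards [hae, hss.ae_apply_zero_eq_zero hX hβ] with ω hω h0 t
  obtain ⟨n, hn⟩ := exists_nat_ge t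
  have hle : ∀ m : ℕ, |X t ω - X 0 ω| ≤ ((m + 1 : ℕ) : ℝ) ^ (-β) := fun m => by
    have h1 := (ofReal_increment_le_truncVar (fun r => X r ω) (((m + 1 : ℕ) : ℝ) ^ (-β))
      (zero_le (a := t))).trans (truncVar_mono_right _ _ zero_le hn)
    rw [hω m n, nonpos_iff_eq_zero, ENNReal.ofReal_eq_zero] at h1
    linarith
  have := ge_of_tendsto' (tendsto_natCast_succ_rpow_neg hβ) hle
  rw [h0, sub_zero] at this
  exact abs_nonpos_iff.1 this

end Degenerate

/-! ### The main theorem. -/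

theorem corollary3 {Ω : Type*} [MeasurableSpace Ω] (P : Measure Ω) [IsProbabilityMeasure P]
    (X : ℝ≥0 → Ω → ℝ) (hX : ∀ t, Measurable (X t))
    (hcadlag : ∀ ω, IsCadlagPath (fun t => X t ω))
    (β : ℝ) (hβ : 0 < β) (hss : IsSelfSimilarProcess P X β)
    (hsi : HasStationaryIncrementsProcess P X)
    (hfin : ∃ c₀ : ℝ, 0 < c₀ ∧ ∫⁻ ω, truncVar (fun t => X t ω) c₀ 0 1 ∂P < ∞)
    (herg : ∀ k : ℕ, 0 < k →
      IsErgodicSequence P (fun (n : ℕ) ω =>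
        truncVar (fun t => X t ω) 1 ((n * k : ℕ) : ℝ≥0) (((n + 1) * k : ℕ) : ℝ≥0))) :
    ∃ C : ℝ, 0 ≤ C ∧
      ((¬ ∀ᵐ ω ∂P, ∀ t, X t ω = 0) → 0 < C) ∧
      Tendsto (fun n : ℕ => (∫⁻ ω, truncVar (fun t => X t ω) 1 0 (n : ℝ≥0) ∂P) / (n : ℝ≥0∞))
        atTop (𝓝 (ENNReal.ofReal C)) ∧
      ∃ c : ℕ → ℝ, (∀ n, 0 < c n) ∧ Tendsto c atTop (𝓝 0) ∧
        ∃ ΩX : Set Ω, MeasurableSet ΩX ∧ P ΩX = 1 ∧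
          ∀ ω ∈ ΩX, ∀ t : ℝ≥0,
            Tendsto (fun n : ℕ =>
                ENNReal.ofReal (c n ^ (1 / β - 1)) * truncVar (fun u => X u ω) (c n) 0 t)
              atTop (𝓝 (ENNReal.ofReal (C * t))) := by
  have hrc : ∀ ω t, ContinuousWithinAt (fun t => X t ω) (Set.Ici t) t := fun ω => (hcadlag ω).1
  have hfin' := lintegral_truncVar_one_ne_top hX hrc hβ hss hsi hfin
  obtain ⟨C, hC, hlim, hgrowth⟩ :=
    exists_tendsto_lintegral_truncVar_div hX hrc hsi fun n => hfin' n
  refine ⟨C, hC, fun hne => ?_, hlim, ?_⟩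
  · refine hC.lt_of_ne' fun h0 => hne (hss.ae_forall_eq_zero hX hrc hβ fun n => ?_)
    simpa [h0] using (hgrowth n).1
  have hmean := tendsto_lintegral_ennDist_truncVar_factorial hX hrc hβ hss fun k hk =>
    eventually_lintegral_ennDist_truncVar_le hX hrc hsi (fun n => hfin' n) hgrowth hk (herg k hk)
  have hcpos : ∀ j : ℕ, 0 < (j.factorial : ℝ) ^ (-β) := fun j =>
    Real.rpow_pos_of_pos (by exact_mod_cast j.factorial_pos) _
  have hmeas : ∀ (j : ℕ) (q : ℚ≥0), Measurable fun ω => ennDist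
      (ENNReal.ofReal (((j.factorial : ℝ) ^ (-β)) ^ (1 / β - 1)) *
        truncVar (fun r => X r ω) ((j.factorial : ℝ) ^ (-β)) 0 (q : ℝ≥0))
      (ENNReal.ofReal (C * (q : ℝ≥0))) := fun j q => by
    have h := measurable_truncVar_process hX hrc (hcpos j).le 0 (q : ℝ≥0)
    exact (h.const_mul _).ennDist_const _
  obtain ⟨φ, hφ, hae⟩ := exists_strictMono_forall_ae_tendsto_zero hmeas hmean
  have hfact : Tendsto (fun n => ((φ n).factorial : ℝ)) atTop atTop :=
    tendsto_atTop_mono (fun n => Nat.cast_le.2 (φ n).self_le_factorial)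
      (tendsto_natCast_atTop_atTop.comp hφ.tendsto_atTop)
  refine ⟨fun n => ((φ n).factorial : ℝ) ^ (-β), fun n => hcpos _,
    (tendsto_rpow_neg_atTop hβ).comp hfact, ?_⟩
  -- The exceptional set is enlarged to a measurable null set, whose complement serves as `ΩX`.
  obtain ⟨s, hsub, hs, hs0⟩ := exists_measurable_superset_of_null (ae_iff.1 hae)
  refine ⟨sᶜ, hs.compl, (prob_compl_eq_one_iff hs).2 hs0, fun ω hω => ?_⟩
  have hω' : ∀ q : ℚ≥0, Tendsto (fun n => ennDist
      (ENNReal.ofReal ((((φ n).factorial : ℝ) ^ (-β)) ^ (1 / β - 1)) *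
        truncVar (fun r => X r ω) (((φ n).factorial : ℝ) ^ (-β)) 0 (q : ℝ≥0))
      (ENNReal.ofReal (C * (q : ℝ≥0)))) atTop (𝓝 0) := by
    by_contra h
    exact hω (hsub h)
  have hmono : ∀ n, Monotone fun t : ℝ≥0 =>
      ENNReal.ofReal ((((φ n).factorial : ℝ) ^ (-β)) ^ (1 / β - 1)) *
        truncVar (fun r => X r ω) (((φ n).factorial : ℝ) ^ (-β)) 0 t := fun n a b hab =>
    mul_le_mul_right (truncVar_mono_right _ _ zero_le hab) _
  exact tendsto_mul_of_tendsto_nnrat hmono C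
    (fun q => tendsto_of_tendsto_ennDist ENNReal.ofReal_ne_top (hω' q)) hC
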